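/- Let $P$ be a finite poset with $n$ elements and let $\omega\colon P\to\{1,\dots,n\}$ be an order-preserving bijection (a natural labeling). A $(P,\omega)$-partition is a map $\theta\colon P\to\mathbb{Z}^+$ such that $\theta(x)\le\theta(y)$ whenever $x\preceq y$, and $\theta(x)<\theta(y)$ whenever $x\preceq y$ and $\omega(x)>\omega(y)$. Let $$K_P(\mathbf{x})=\sum_{\theta}x_1^{|\theta^{-1}(1)|}x_2^{|\theta^{-1}(2)|}\cdots,$$ where the sum ranges over all $(P,\omega)$-partitions $\theta$; it belongs to the $\mathbb{C}$-algebra $\mathrm{QSym}$ of quasisymmetric functions, that is, of the formal power series over $\mathbb{C}$ of bounded degree in $x_1,x_2,\dots$ in which, for every composition $(\alpha_1,\dots,\alpha_k)$ and all $i_1<\dots<i_k$, the coefficients of $x_{i_1}^{\alpha_1}\cdots x_{i_k}^{\alpha_k}$ and of $x_1^{\alpha_1}\cdots x_k^{\alpha_k}$ are equal. Call $P$ connected if its Hasse diagram is a connected (in particular nonempty) graph. Then $P$ is connected if and only if $K_P(\mathbf{x})$ is irreducible in $\mathrm{QSym}$. -/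

import Mathlib

/-!
Quasisymmetric functions over `ℂ` in the variables `x₁, x₂, …` (indexed by `ℕ+`), and
`(P, ω)`-partition generating functions of finite labeled posets.
-/

/-- A formal power series has bounded degree if the degrees of the monomials that occur in it
are bounded. -/
def BoundedDegree (f : MvPowerSeries ℕ+ ℂ) : Prop :=
  ∃ d : ℕ, ∀ m : ℕ+ →₀ ℕ, MvPowerSeries.coeff m f ≠ 0 → m.degree ≤ d

/-- For every composition `α = (α₁, …, α_k)` and all `i₁ < ⋯ < i_k`, the coefficient of
`x_{i₁}^{α₁} ⋯ x_{i_k}^{α_k}` equals the coefficient of `x₁^{α₁} ⋯ x_k^{α_k}`. -/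
def ShiftInvariant (f : MvPowerSeries ℕ+ ℂ) : Prop :=
  ∀ (k : ℕ) (α : Fin k → ℕ+) (i : Fin k → ℕ+), StrictMono i →
    MvPowerSeries.coeff (∑ j, Finsupp.single (i j) (α j : ℕ)) f =
      MvPowerSeries.coeff (∑ j : Fin k, Finsupp.single (Nat.succPNat j) (α j : ℕ)) f

/-- Helper: the same coefficient condition with exponents that are allowed to be zero. -/
theorem ShiftInvariant.weak {f : MvPowerSeries ℕ+ ℂ} (hf : ShiftInvariant f) {k : ℕ}
    (a : Fin k → ℕ) {i i' : Fin k → ℕ+} (hi : StrictMono i) (hi' : StrictMono i') :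
    MvPowerSeries.coeff (∑ j, Finsupp.single (i j) (a j)) f =
      MvPowerSeries.coeff (∑ j, Finsupp.single (i' j) (a j)) f := by
  classical
  set s : Finset (Fin k) := Finset.univ.filter fun j => a j ≠ 0 with hs
  let e : Fin s.card ≃o s := s.orderIsoOfFin rfl
  have hpos : ∀ j : Fin s.card, 0 < a (e j) := fun j =>
    Nat.pos_of_ne_zero (Finset.mem_filter.1 (e j).2).2
  have key : ∀ l : Fin k → ℕ+, ∑ j, Finsupp.single (l j) (a j) =
      ∑ j : Fin s.card, Finsupp.single (l (e j)) (((⟨a (e j), hpos j⟩ : ℕ+)) : ℕ) := by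
    intro l
    have h1 : ∑ j, Finsupp.single (l j) (a j) = ∑ j ∈ s, Finsupp.single (l j) (a j) := by
      symm
      apply Finset.sum_subset (Finset.subset_univ _)
      intro j _ hj
      have : a j = 0 := by simpa [hs] using hj
      simp [this]
    rw [h1, ← Finset.sum_coe_sort s]
    exact (Equiv.sum_comp e.toEquiv
      (fun x : s => Finsupp.single (l x) (a x))).symm
  have hmono : ∀ l : Fin k → ℕ+, StrictMono l → StrictMono fun j => l (e j) := by
    intro l hl x y hxy
    exact hl (e.strictMono hxy)
  rw [key i, key i']
  exact (hf _ (fun j => ⟨a (e j), hpos j⟩) _ (hmono i hi)).trans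
    (hf _ (fun j => ⟨a (e j), hpos j⟩) _ (hmono i' hi')).symm

/-- Helper: exponents below `∑ j, a j • i j` come from exponents below `a`. -/
theorem exists_eq_sum_single {k : ℕ} {i : Fin k → ℕ+} (hi : StrictMono i) (a : Fin k → ℕ)
    {u v : ℕ+ →₀ ℕ} (h : u + v = ∑ j, Finsupp.single (i j) (a j)) :
    u = ∑ j, Finsupp.single (i j) (u (i j)) := by
  classical
  ext x
  rw [Finsupp.finsetSum_apply]
  by_cases hx : ∃ j, i j = x
  · obtain ⟨j, rfl⟩ := hx
    rw [Finset.sum_eq_single j]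
    · simp
    · intro b _ hb
      simp [hi.injective.ne hb]
    · simp
  · have h0 : (u + v) x = 0 := by
      rw [h, Finsupp.finsetSum_apply]
      exact Finset.sum_eq_zero fun j _ => by
        rw [Finsupp.single_apply, if_neg fun h => hx ⟨j, h⟩]
    have : u x = 0 := by simp at h0; exact h0.1
    rw [this]
    symm
    exact Finset.sum_eq_zero fun j _ => by
      rw [Finsupp.single_apply, if_neg fun h => hx ⟨j, h⟩]

/-- Helper: evaluation of a monomial exponent supported on an increasing sequence. -/
theorem sum_single_apply_of_strictMono {k : ℕ} {i : Fin k → ℕ+} (hi : StrictMono i)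
    (a : Fin k → ℕ) (j : Fin k) : (∑ l, Finsupp.single (i l) (a l)) (i j) = a j := by
  classical
  rw [Finsupp.finsetSum_apply, Finset.sum_eq_single j]
  · simp
  · intro b _ hb
    simp [hi.injective.ne hb]
  · simp

theorem strictMono_succPNat (k : ℕ) : StrictMono fun j : Fin k => Nat.succPNat j := by
  intro x y h
  exact Nat.succPNat_lt_succPNat.2 h

/-- Helper: the product of two series satisfying the coefficient condition satisfies it. -/
theorem ShiftInvariant.mul {f g : MvPowerSeries ℕ+ ℂ} (hf : ShiftInvariant f)
    (hg : ShiftInvariant g) : ShiftInvariant (f * g) := by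
  classical
  intro k α i hi
  have hi' : StrictMono fun j : Fin k => Nat.succPNat j := strictMono_succPNat k
  rw [MvPowerSeries.coeff_mul, MvPowerSeries.coeff_mul]
  have aux : ∀ {l l' : Fin k → ℕ+}, StrictMono l → ∀ p : (ℕ+ →₀ ℕ) × (ℕ+ →₀ ℕ),
      p.1 + p.2 = ∑ j, Finsupp.single (l j) (α j : ℕ) →
      (∑ j, Finsupp.single (l' j) (p.1 (l j))) + (∑ j, Finsupp.single (l' j) (p.2 (l j))) =
        ∑ j, Finsupp.single (l' j) (α j : ℕ) := by
    intro l l' hl p hp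
    rw [← Finset.sum_add_distrib]
    refine Finset.sum_congr rfl fun j _ => ?_
    rw [← Finsupp.single_add, ← Finsupp.add_apply, hp,
      sum_single_apply_of_strictMono hl (fun j => (α j : ℕ))]
  have rnd : ∀ {l l' : Fin k → ℕ+}, StrictMono l' → ∀ a : Fin k → ℕ,
      ∑ j, Finsupp.single (l j) ((∑ t, Finsupp.single (l' t) (a t)) (l' j)) =
        ∑ j, Finsupp.single (l j) (a j) := fun hl a =>
    Finset.sum_congr rfl fun j _ => by rw [sum_single_apply_of_strictMono hl a j]
  refine Finset.sum_bij'
    (fun p _ => (∑ j : Fin k, Finsupp.single (Nat.succPNat j) (p.1 (i j)),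
      ∑ j : Fin k, Finsupp.single (Nat.succPNat j) (p.2 (i j))))
    (fun p _ => (∑ j, Finsupp.single (i j) (p.1 (Nat.succPNat j)),
      ∑ j, Finsupp.single (i j) (p.2 (Nat.succPNat j))))
    ?_ ?_ ?_ ?_ ?_
  · intro p hp
    rw [Finset.HasAntidiagonal.mem_antidiagonal] at hp ⊢
    exact aux hi p hp
  · intro p hp
    rw [Finset.HasAntidiagonal.mem_antidiagonal] at hp ⊢
    exact aux hi' p hp
  · intro p hp
    rw [Finset.HasAntidiagonal.mem_antidiagonal] at hp
    have h1 := exists_eq_sum_single hi _ hp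
    have h2 := exists_eq_sum_single hi _ ((add_comm _ _).trans hp)
    exact Prod.ext ((rnd hi' fun j => p.1 (i j)).trans h1.symm)
      ((rnd hi' fun j => p.2 (i j)).trans h2.symm)
  · intro p hp
    rw [Finset.HasAntidiagonal.mem_antidiagonal] at hp
    have h1 := exists_eq_sum_single hi' _ hp
    have h2 := exists_eq_sum_single hi' _ ((add_comm _ _).trans hp)
    exact Prod.ext ((rnd hi fun j => p.1 (Nat.succPNat j)).trans h1.symm)
      ((rnd hi fun j => p.2 (Nat.succPNat j)).trans h2.symm)
  · intro p hp
    rw [Finset.HasAntidiagonal.mem_antidiagonal] at hp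
    have h1 := exists_eq_sum_single hi _ hp
    have h2 := exists_eq_sum_single hi _ ((add_comm _ _).trans hp)
    have e1 := hf.weak (fun j => p.1 (i j)) hi hi'
    have e2 := hg.weak (fun j => p.2 (i j)) hi hi'
    rw [← h1] at e1
    rw [← h2] at e2
    exact congrArg₂ (· * ·) e1 e2

/-- The `ℂ`-algebra `QSym` of quasisymmetric functions. -/
def QSym : Subalgebra ℂ (MvPowerSeries ℕ+ ℂ) where
  carrier := {f | BoundedDegree f ∧ ShiftInvariant f}
  mul_mem' := by
    classical
    rintro f g ⟨⟨d, hd⟩, hf⟩ ⟨⟨d', hd'⟩, hg⟩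
    refine ⟨⟨d + d', fun m hm => ?_⟩, hf.mul hg⟩
    rw [MvPowerSeries.coeff_mul] at hm
    obtain ⟨p, hp, hne⟩ := Finset.exists_ne_zero_of_sum_ne_zero hm
    rw [Finset.HasAntidiagonal.mem_antidiagonal] at hp
    rw [← hp, map_add]
    exact add_le_add (hd _ (left_ne_zero_of_mul hne)) (hd' _ (right_ne_zero_of_mul hne))
  add_mem' := by
    rintro f g ⟨⟨d, hd⟩, hf⟩ ⟨⟨d', hd'⟩, hg⟩
    refine ⟨⟨max d d', fun m hm => ?_⟩, fun k α i hi => ?_⟩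
    · by_cases h : MvPowerSeries.coeff m f = 0
      · refine le_max_of_le_right (hd' m fun h' => hm ?_)
        rw [map_add, h, h', add_zero]
      · exact le_max_of_le_left (hd m h)
    · rw [map_add, map_add, hf k α i hi, hg k α i hi]
  algebraMap_mem' := by
    classical
    intro r
    refine ⟨⟨0, fun m hm => ?_⟩, fun k α i hi => ?_⟩
    · rw [MvPowerSeries.algebraMap_apply, MvPowerSeries.coeff_C] at hm
      have : m = 0 := by
        by_contra h
        exact hm (if_neg h)
      simp [this]
    · have key : ∀ l : Fin k → ℕ+,
          (∑ j, Finsupp.single (l j) (α j : ℕ) = 0) ↔ IsEmpty (Fin k) := by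
        intro l
        rw [Finset.sum_eq_zero_iff]
        simp [isEmpty_iff]
      rw [MvPowerSeries.algebraMap_apply, MvPowerSeries.coeff_C, MvPowerSeries.coeff_C]
      simp only [key]

/-- A labeling `ω : P → {1, …, n}`, a bijection; the labels are shifted to `{0, …, n - 1}`,
and only their order matters. -/
abbrev Labeling (P : Type*) [Fintype P] : Type _ := P ≃ Fin (Fintype.card P)

/-- A labeled poset is naturally labeled if its labeling is order-preserving. -/
def Labeling.IsNatural {P : Type*} [PartialOrder P] [Fintype P] (ω : Labeling P) : Prop :=
  ∀ x y : P, x ≤ y → ω x ≤ ω y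

/-- `(P, ω)`-partitions `θ : P → T`. They are used for `T = ℕ+`; other linear orders `T` occur
only in helper facts. -/
structure IsPPartition {P : Type*} [PartialOrder P] [Fintype P] {T : Type*} [LinearOrder T]
    (ω : Labeling P) (θ : P → T) : Prop where
  le_of_le : ∀ x y : P, x ≤ y → θ x ≤ θ y
  lt_of_le_of_lt : ∀ x y : P, x ≤ y → ω y < ω x → θ x < θ y

/-- The exponent of the monomial `x₁^{|θ⁻¹(1)|} x₂^{|θ⁻¹(2)|} ⋯`, that is, of the product of the
variables `x_{θ p}` over all `p : P`. -/
noncomputable def weight {P : Type*} [Fintype P] {T : Type*} (θ : P → T) : T →₀ ℕ :=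
  ∑ p, Finsupp.single (θ p) 1

/-- The exponent of `x_t` in the monomial of `θ` is `|θ⁻¹(t)|`. -/
theorem weight_apply {P : Type*} [Fintype P] {T : Type*} (θ : P → T) (t : T) :
    weight θ t = (θ ⁻¹' {t}).ncard := by
  classical
  have h : θ ⁻¹' {t} = ((Finset.univ.filter fun p => θ p = t : Finset P) : Set P) := by
    ext p; simp
  rw [h, Set.ncard_coe_finset, weight, Finsupp.finsetSum_apply, Finset.card_filter]
  exact Finset.sum_congr rfl fun p _ => by rw [Finsupp.single_apply]

/-- Only finitely many maps `θ : P → ℕ+` have a given monomial. -/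
theorem finite_weight_eq {P : Type*} [Fintype P] {T : Type*} (m : T →₀ ℕ) :
    {θ : P → T | weight θ = m}.Finite := by
  classical
  refine (Set.Finite.pi (ι := P) fun _ => m.support.finite_toSet).subset ?_
  rintro θ rfl p -
  rw [Finset.mem_coe, Finsupp.mem_support_iff, weight_apply, Ne,
    Set.ncard_eq_zero (Set.toFinite _)]
  exact Set.Nonempty.ne_empty ⟨p, rfl⟩

/-- The `(P, ω)`-partition generating function as a formal power series: the sum of the monomials
of all `(P, ω)`-partitions, so that the coefficient at `m` is the (finite) number of
`(P, ω)`-partitions whose monomial is `m`. -/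
noncomputable def partitionSeries {P : Type*} [PartialOrder P] [Fintype P] (ω : Labeling P) :
    MvPowerSeries ℕ+ ℂ :=
  fun m => ((Nat.card {θ : P → ℕ+ // IsPPartition ω θ ∧ weight θ = m} : ℕ) : ℂ)

/-- Helper. -/
theorem coeff_partitionSeries {P : Type*} [PartialOrder P] [Fintype P] (ω : Labeling P)
    (m : ℕ+ →₀ ℕ) : MvPowerSeries.coeff m (partitionSeries ω) =
      ((Nat.card {θ : P → ℕ+ // IsPPartition ω θ ∧ weight θ = m} : ℕ) : ℂ) :=
  rfl

/-- Helper: `(P, ω)`-partitions with monomial in the variables `x_{i j}` correspond to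
`(P, ω)`-partitions with values in `Fin k`. -/
theorem card_partition_eq {P : Type*} [PartialOrder P] [Fintype P] (ω : Labeling P) {k : ℕ}
    {i : Fin k → ℕ+} (hi : StrictMono i) (a : Fin k → ℕ) :
    Nat.card {θ : P → ℕ+ // IsPPartition ω θ ∧ weight θ = ∑ j, Finsupp.single (i j) (a j)} =
      Nat.card {θ : P → Fin k // IsPPartition ω θ ∧ weight θ = ∑ j, Finsupp.single j (a j)} := by
  classical
  have hw : ∀ θ : P → Fin k, weight (i ∘ θ) = Finsupp.mapDomain i (weight θ) := by
    intro θ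
    simp [weight, Finsupp.mapDomain_finsetSum, Finsupp.mapDomain_single]
  have ha : ∑ j, Finsupp.single (i j) (a j) =
      Finsupp.mapDomain i (∑ j, Finsupp.single j (a j)) := by
    simp [Finsupp.mapDomain_finsetSum, Finsupp.mapDomain_single]
  have hp : ∀ θ : P → Fin k, IsPPartition ω (i ∘ θ) ↔ IsPPartition ω θ := fun θ =>
    ⟨fun h => ⟨fun x y hxy => hi.le_iff_le.1 (h.1 x y hxy),
      fun x y hxy hlt => hi.lt_iff_lt.1 (h.2 x y hxy hlt)⟩,
     fun h => ⟨fun x y hxy => hi.le_iff_le.2 (h.1 x y hxy),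
      fun x y hxy hlt => hi.lt_iff_lt.2 (h.2 x y hxy hlt)⟩⟩
  symm
  refine Nat.card_congr (Equiv.ofBijective
    (fun θ => ⟨i ∘ θ.1, (hp _).2 θ.2.1, by rw [hw, ha, θ.2.2]⟩) ⟨?_, ?_⟩)
  · rintro ⟨θ, _⟩ ⟨θ', _⟩ h
    exact Subtype.ext (hi.injective.comp_left (congrArg Subtype.val h))
  · rintro ⟨θ, h1, h2⟩
    have hr : ∀ p, ∃ j, i j = θ p := by
      intro p
      by_contra hne
      have h0 : weight θ (θ p) = 0 := by
        rw [h2, Finsupp.finsetSum_apply]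
        exact Finset.sum_eq_zero fun j _ => by
          rw [Finsupp.single_apply, if_neg fun h => hne ⟨j, h⟩]
      rw [weight_apply, Set.ncard_eq_zero (Set.toFinite _)] at h0
      exact Set.Nonempty.ne_empty (s := θ ⁻¹' {θ p}) ⟨p, rfl⟩ h0
    choose η hη using hr
    obtain rfl : i ∘ η = θ := funext hη
    refine ⟨⟨η, (hp η).1 h1, ?_⟩, rfl⟩
    rw [hw, ha] at h2
    exact Finsupp.mapDomain_injective hi.injective h2

/-- The series of a labeled poset is a quasisymmetric function. -/
theorem partitionSeries_mem_QSym {P : Type*} [PartialOrder P] [Fintype P] (ω : Labeling P) :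
    partitionSeries ω ∈ QSym := by
  refine ⟨⟨Fintype.card P, fun m hm => ?_⟩, fun k α i hi => ?_⟩
  · rw [coeff_partitionSeries, Nat.cast_ne_zero] at hm
    obtain ⟨⟨θ, -, rfl⟩⟩ := (Nat.card_ne_zero.1 hm).1
    simp [weight, map_sum]
  · rw [coeff_partitionSeries, coeff_partitionSeries, card_partition_eq ω hi (fun j => (α j : ℕ)),
      card_partition_eq ω (strictMono_succPNat k) (fun j => (α j : ℕ))]

/-- The `(P, ω)`-partition generating function `K_{(P, ω)}` as an element of `QSym`. -/
noncomputable def partitionGenFun {P : Type*} [PartialOrder P] [Fintype P] (ω : Labeling P) :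
    QSym :=
  ⟨partitionSeries ω, partitionSeries_mem_QSym ω⟩

/-- A poset is connected if its Hasse diagram is a connected (in particular nonempty) graph. -/
def IsConnectedPoset (P : Type*) [PartialOrder P] : Prop :=
  (SimpleGraph.hasse P).Connected

/-! Taking the coefficient of `x₁ ^ k` and renumbering the other variables gives operators
`headCoeff k` on `QSym`, and `∑ headCoeff k · t ^ k` is multiplicative. Its logarithmic derivative
therefore consists of derivations `powerDer k` (`powerOp_mul`). Applied to the generating function
of a subset `S` of the poset, `powerDer c` removes in all possible ways a principal lower set having
exactly `c` elements in `S` (`powerOp_posetGenFun`).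

Commutators of derivations are derivations, and a derivation sends a product of two series without
constant term to a series without constant term. So for connected `P` it is enough to find a nested
commutator `D` such that `D K_P` has a nonzero constant term: then in any factorization some factor
has a nonzero constant term, and homogeneity of `K_P` makes that factor constant
(`isUnit_of_mul_homogeneous`).

Such a `D` is found on formal combinations of subsets. A nested commutator expands over lists of
elements of `P`, and the coefficient at `∅` sees only lists whose lower sets cover `P`. At the
minimal length of a cover, lists in which some lower set is disjoint from the later ones contribute
nothing. If the prescribed sizes are lexicographically maximal among the remaining lists, every
contribution is `0` or `1`, and some contribution is `1` (`exists_nestedSum_pos`). Connectedness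
supplies a linked list of minimal length (`exists_linked_cover`).

Conversely, a splitting of `P` into mutually incomparable nonempty parts factors `K_P`
(`posetGenFun_union`). -/

open Finset in
/-- Reindexing of a sum over triples with a given sum. -/
theorem sum_antidiagonal_triple {M : Type*} [AddCommMonoid M] (F : ℕ → ℕ → ℕ → M) (k : ℕ) :
    ∑ x ∈ HasAntidiagonal.antidiagonal k, ∑ y ∈ HasAntidiagonal.antidiagonal x.1, F y.1 y.2 x.2 =
      ∑ x ∈ HasAntidiagonal.antidiagonal k, ∑ y ∈ HasAntidiagonal.antidiagonal x.1, F y.1 x.2 y.2 := by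
  rw [Finset.sum_sigma', Finset.sum_sigma']
  refine Finset.sum_nbij' (fun z => ⟨(z.2.1 + z.1.2, z.2.2), (z.2.1, z.1.2)⟩)
    (fun z => ⟨(z.2.1 + z.1.2, z.2.2), (z.2.1, z.1.2)⟩) ?_ ?_ ?_ ?_ ?_
  · rintro ⟨⟨a, b⟩, ⟨c, d⟩⟩ h
    simp only [mem_sigma, HasAntidiagonal.mem_antidiagonal] at h ⊢
    exact ⟨by omega, trivial⟩
  · rintro ⟨⟨a, b⟩, ⟨c, d⟩⟩ h
    simp only [mem_sigma, HasAntidiagonal.mem_antidiagonal] at h ⊢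
    exact ⟨by omega, trivial⟩
  · rintro ⟨⟨a, b⟩, ⟨c, d⟩⟩ h
    simp only [mem_sigma, HasAntidiagonal.mem_antidiagonal] at h ⊢
    obtain ⟨h1, rfl⟩ := h
    rfl
  · rintro ⟨⟨a, b⟩, ⟨c, d⟩⟩ h
    simp only [mem_sigma, HasAntidiagonal.mem_antidiagonal] at h ⊢
    obtain ⟨h1, rfl⟩ := h
    rfl
  · rintro ⟨⟨a, b⟩, ⟨c, d⟩⟩ h
    rfl

/-! ### Derivations of `QSym` from the expansion in the first variable. -/

namespace QSym

/-- The exponent with `x₁`-part `k` and the other variables given by `m`, shifted by one. -/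
noncomputable def consExp (k : ℕ) (m : ℕ+ →₀ ℕ) : ℕ+ →₀ ℕ :=
  Finsupp.single 1 k + m.mapDomain (· + 1)

theorem consExp_one (k : ℕ) (m : ℕ+ →₀ ℕ) : consExp k m 1 = k := by
  rw [consExp, Finsupp.add_apply, Finsupp.single_eq_same, Finsupp.mapDomain_of_notMem_range, add_zero]
  rintro ⟨x, hx⟩
  exact (PNat.lt_add_left 1 x).ne' hx

theorem consExp_add_one (k : ℕ) (m : ℕ+ →₀ ℕ) (i : ℕ+) : consExp k m (i + 1) = m i := by
  rw [consExp, Finsupp.add_apply, Finsupp.single_eq_of_ne (PNat.lt_add_left 1 i).ne', zero_add,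
    Finsupp.mapDomain_apply (add_left_injective (1 : ℕ+))]

theorem consExp_add (k l : ℕ) (m n : ℕ+ →₀ ℕ) :
    consExp (k + l) (m + n) = consExp k m + consExp l n := by
  rw [consExp, consExp, consExp, Finsupp.single_add, Finsupp.mapDomain_add]
  abel

theorem degree_consExp (k : ℕ) (m : ℕ+ →₀ ℕ) : (consExp k m).degree = k + m.degree := by
  rw [consExp, map_add, Finsupp.degree_single]
  congr 1
  induction m using Finsupp.induction_linear with
  | zero => simp
  | add f g hf hg => rw [Finsupp.mapDomain_add, map_add, map_add, hf, hg]
  | single a b => simp [Finsupp.mapDomain_single]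

/-- Removal of the first exponent. -/
noncomputable def tailExp (m : ℕ+ →₀ ℕ) : ℕ+ →₀ ℕ :=
  m.comapDomain (· + 1) (add_left_injective (1 : ℕ+)).injOn

theorem tailExp_apply (m : ℕ+ →₀ ℕ) (i : ℕ+) : tailExp m i = m (i + 1) :=
  rfl

theorem tailExp_add (m n : ℕ+ →₀ ℕ) : tailExp (m + n) = tailExp m + tailExp n :=
  Finsupp.ext fun _ => rfl

theorem tailExp_consExp (k : ℕ) (m : ℕ+ →₀ ℕ) : tailExp (consExp k m) = m :=
  Finsupp.ext fun i => by rw [tailExp_apply, consExp_add_one]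

theorem consExp_tailExp (m : ℕ+ →₀ ℕ) : consExp (m 1) (tailExp m) = m := by
  ext i
  by_cases h : i = 1
  · rw [h, consExp_one]
  · obtain ⟨j, rfl⟩ := PNat.exists_eq_succ_of_ne_one h
    rw [consExp_add_one, tailExp_apply]

/-- The coefficient of `x₁ ^ k` in `f(x₁, x₂, …)`, with the other variables renumbered. -/
noncomputable def headCoeff (k : ℕ) : QSym →ₗ[ℂ] QSym where
  toFun f := ⟨fun m => MvPowerSeries.coeff (consExp k m) f.1, by
    obtain ⟨f, ⟨d, hd⟩, hf⟩ := f
    refine ⟨⟨d, fun m hm => ?_⟩, fun n α i hi => ?_⟩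
    · have := hd _ hm
      rw [degree_consExp] at this
      omega
    · have key : ∀ l : Fin n → ℕ+, consExp k (∑ j, Finsupp.single (l j) (α j : ℕ)) =
          ∑ j : Fin (n + 1), Finsupp.single
            ((Fin.cons 1 fun j => l j + 1 : Fin (n + 1) → ℕ+) j)
            ((Fin.cons k fun j => (α j : ℕ) : Fin (n + 1) → ℕ) j) := by
        intro l
        simp [Fin.sum_univ_succ, consExp, Finsupp.mapDomain_finsetSum, Finsupp.mapDomain_single]
      have mono : ∀ l : Fin n → ℕ+, StrictMono l →
          StrictMono (Fin.cons 1 fun j => l j + 1 : Fin (n + 1) → ℕ+) := by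
        intro l hl
        rw [Fin.strictMono_cons]
        exact ⟨fun _ => PNat.lt_add_left 1 _, fun a b h => by simpa using hl h⟩
      change MvPowerSeries.coeff (consExp k _) f = MvPowerSeries.coeff (consExp k _) f
      rw [key, key]
      exact ShiftInvariant.weak hf _ (mono _ hi) (mono _ (strictMono_succPNat n))⟩
  map_add' _ _ := rfl
  map_smul' _ _ := rfl

theorem coeff_headCoeff (k : ℕ) (f : QSym) (m : ℕ+ →₀ ℕ) :
    MvPowerSeries.coeff m (headCoeff k f).1 = MvPowerSeries.coeff (consExp k m) f.1 :=
  rfl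

/-- Shifting all variables by one keeps their order, so quasisymmetry leaves every coefficient
unchanged. -/
theorem headCoeff_zero (f : QSym) : headCoeff 0 f = f := by
  refine Subtype.ext (MvPowerSeries.ext fun m => ?_)
  rw [coeff_headCoeff]
  have h1 : m = ∑ j, Finsupp.single (m.support.orderEmbOfFin rfl j)
      (m (m.support.orderEmbOfFin rfl j)) := by
    conv_lhs => rw [← m.sum_single, Finsupp.sum, ← Finset.sum_coe_sort]
    exact (Equiv.sum_comp (m.support.orderIsoOfFin rfl).toEquiv
      fun x => Finsupp.single x.1 (m x.1)).symm
  have h2 : consExp 0 m = ∑ j, Finsupp.single (m.support.orderEmbOfFin rfl j + 1)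
      (m (m.support.orderEmbOfFin rfl j)) := by
    conv_lhs => rw [h1]
    simp [consExp, Finsupp.mapDomain_finsetSum, Finsupp.mapDomain_single]
  rw [h2]
  conv_rhs => rw [h1]
  exact f.2.2.weak _ (fun a b h => by simpa using h) (OrderEmbedding.strictMono _)

/-- Splitting an exponent splits its first entry and its tail independently; this is
multiplicativity of the expansion in `x₁`. -/
theorem headCoeff_mul (k : ℕ) (f g : QSym) :
    headCoeff k (f * g) = ∑ x ∈ Finset.HasAntidiagonal.antidiagonal k, headCoeff x.1 f * headCoeff x.2 g := by
  classical
  refine Subtype.ext (MvPowerSeries.ext fun m => ?_)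
  rw [coeff_headCoeff, AddSubmonoidClass.coe_finsetSum, map_sum]
  simp only [MulMemClass.coe_mul, MvPowerSeries.coeff_mul, coeff_headCoeff]
  rw [← Finset.sum_product']
  refine Finset.sum_nbij' (fun p => ((p.1 1, p.2 1), (tailExp p.1, tailExp p.2)))
    (fun q => (consExp q.1.1 q.2.1, consExp q.1.2 q.2.2)) ?_ ?_ ?_ ?_ ?_
  · intro p hp
    rw [Finset.HasAntidiagonal.mem_antidiagonal] at hp
    rw [Finset.mem_product, Finset.HasAntidiagonal.mem_antidiagonal, Finset.HasAntidiagonal.mem_antidiagonal]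
    exact ⟨by rw [← consExp_one k m, ← hp, Finsupp.add_apply],
      by rw [← tailExp_add, hp, tailExp_consExp]⟩
  · intro q hq
    rw [Finset.mem_product, Finset.HasAntidiagonal.mem_antidiagonal, Finset.HasAntidiagonal.mem_antidiagonal] at hq
    rw [Finset.HasAntidiagonal.mem_antidiagonal, ← consExp_add, hq.1, hq.2]
  · intro p _
    exact Prod.ext (consExp_tailExp _) (consExp_tailExp _)
  · intro q _
    simp only [consExp_one, tailExp_consExp]
  · intro p _
    simp only [consExp_tailExp]

/-- Linear operators with `∑ headCoeff i ∘ deriv j = k • headCoeff k`, the sum being over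
`i + j = k`. They remove a first part of size `k` via the noncommutative power sums. -/
noncomputable def powerOp (k : ℕ) : QSym →ₗ[ℂ] QSym :=
  k • headCoeff k - ∑ j : Fin k, headCoeff (k - j) ∘ₗ powerOp j
termination_by k
decreasing_by exact j.2

theorem sum_antidiagonal_headCoeff (X : ℕ → QSym) (k : ℕ) :
    ∑ x ∈ Finset.HasAntidiagonal.antidiagonal k, headCoeff x.1 (X x.2) =
      X k + ∑ j : Fin k, headCoeff (k - j) (X j) := by
  rw [← Finset.Nat.sum_antidiagonal_swap]
  rw [Finset.Nat.sum_antidiagonal_eq_sum_range_succ_mk, Finset.sum_range_succ, add_comm,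
    Finset.sum_range]
  simp [headCoeff_zero]

theorem sum_headCoeff_powerOp (k : ℕ) (f : QSym) :
    ∑ x ∈ Finset.HasAntidiagonal.antidiagonal k, headCoeff x.1 (powerOp x.2 f) = k • headCoeff k f := by
  rw [sum_antidiagonal_headCoeff (fun j => powerOp j f), powerOp]
  simp

/-- Since `headCoeff 0` is the identity, the recursion determines its solution. A formula for
`powerOp` is thus proved by checking that the proposed values satisfy the recursion. -/
theorem eq_powerOp {f : QSym} {X : ℕ → QSym}
    (h : ∀ k, ∑ x ∈ Finset.HasAntidiagonal.antidiagonal k, headCoeff x.1 (X x.2) = k • headCoeff k f) (k : ℕ) :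
    X k = powerOp k f := by
  induction k using Nat.strong_induction_on with
  | _ k ih =>
    have h1 := (h k).trans (sum_headCoeff_powerOp k f).symm
    rw [sum_antidiagonal_headCoeff X, sum_antidiagonal_headCoeff fun j => powerOp j f] at h1
    simp only [ih _ (Fin.is_lt _)] at h1
    exact add_right_cancel h1

/-- The logarithmic derivative of a multiplicative family obeys the Leibniz rule. -/
theorem powerOp_mul (k : ℕ) (f g : QSym) :
    powerOp k (f * g) = f * powerOp k g + g * powerOp k f := by
  symm
  refine eq_powerOp (X := fun k => f * powerOp k g + g * powerOp k f) (fun k => ?_) k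
  -- Each half of the Leibniz expression yields products weighted by the index of one factor; the
  -- two weights add up to `k`.
  have key : ∀ f g : QSym, ∑ x ∈ Finset.HasAntidiagonal.antidiagonal k, headCoeff x.1 (g * powerOp x.2 f) =
      ∑ x ∈ Finset.HasAntidiagonal.antidiagonal k, x.1 • (headCoeff x.1 f * headCoeff x.2 g) := by
    intro f g
    simp only [mul_comm g, headCoeff_mul]
    rw [sum_antidiagonal_triple fun a b c => headCoeff a (powerOp c f) * headCoeff b g]
    refine Finset.sum_congr rfl fun x _ => ?_
    rw [← Finset.sum_mul, sum_headCoeff_powerOp, smul_mul_assoc]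
  simp only [map_add, Finset.sum_add_distrib]
  rw [key f g, key g f, ← Finset.Nat.sum_antidiagonal_swap, ← Finset.sum_add_distrib, headCoeff_mul,
    Finset.smul_sum]
  refine Finset.sum_congr rfl fun x hx => ?_
  rw [Finset.HasAntidiagonal.mem_antidiagonal] at hx
  simp only [Prod.fst_swap, Prod.snd_swap]
  rw [mul_comm (headCoeff x.2 g), ← add_smul, add_comm, hx]

/-- `powerOp k` as a derivation. -/
noncomputable def powerDer (k : ℕ) : Derivation ℂ QSym QSym :=
  Derivation.mk' (powerOp k) (powerOp_mul k)

theorem powerDer_apply (k : ℕ) (f : QSym) : powerDer k f = powerOp k f :=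
  rfl

/-! ### Constant terms and factors of homogeneous series. -/

/-- The constant coefficient. -/
noncomputable def constCoeff : QSym →+* ℂ :=
  (MvPowerSeries.constantCoeff (σ := ℕ+) (R := ℂ)).comp QSym.val.toRingHom

theorem constCoeff_apply (f : QSym) : constCoeff f = MvPowerSeries.coeff 0 f.1 :=
  rfl

theorem constCoeff_derivation_mul (D : Derivation ℂ QSym QSym) {f g : QSym}
    (hf : constCoeff f = 0) (hg : constCoeff g = 0) : constCoeff (D (f * g)) = 0 := by
  simp [hf, hg]

/-- If a product of quasisymmetric functions is homogeneous and one factor has a nonzero constant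
coefficient, then this factor is constant. -/
theorem isUnit_of_mul_homogeneous {f g : QSym} {n : ℕ} (hfg : f * g ≠ 0)
    (hn : ∀ m, MvPowerSeries.coeff m (f * g).1 ≠ 0 → m.degree = n) (hf : constCoeff f ≠ 0) :
    IsUnit f := by
  classical
  have top : ∀ h : QSym, h ≠ 0 → ∃ a, (∃ m, m.degree = a ∧ MvPowerSeries.coeff m h.1 ≠ 0) ∧
      ∀ m, MvPowerSeries.coeff m h.1 ≠ 0 → m.degree ≤ a := by
    intro h hh
    obtain ⟨d, hd⟩ := h.2.1
    have hne : ∃ m, MvPowerSeries.coeff m h.1 ≠ 0 := by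
      by_contra! hc
      exact hh (Subtype.ext (MvPowerSeries.ext hc))
    obtain ⟨m, hm, hmax⟩ := Set.exists_max_image
      {a : ℕ | ∃ m, m.degree = a ∧ MvPowerSeries.coeff m h.1 ≠ 0} id
      ((Set.finite_le_nat d).subset (by rintro _ ⟨m, rfl, hm⟩; exact hd m hm))
      (by obtain ⟨m, hm⟩ := hne; exact ⟨_, m, rfl, hm⟩)
    exact ⟨m, hm, fun m' hm' => hmax _ ⟨m', rfl, hm'⟩⟩
  obtain ⟨a, ⟨ma, hma, hfa⟩, ha⟩ := top f (left_ne_zero_of_mul hfg)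
  obtain ⟨b, ⟨mb, hmb, hgb⟩, hb⟩ := top g (right_ne_zero_of_mul hfg)
  let part : MvPowerSeries ℕ+ ℂ → ℕ → MvPowerSeries ℕ+ ℂ := fun h a m =>
    if m.degree = a then MvPowerSeries.coeff m h else 0
  have hpart : ∀ h a m, MvPowerSeries.coeff m (part h a) =
      if m.degree = a then MvPowerSeries.coeff m h else 0 := fun _ _ _ => rfl
  -- Power series over `ℂ` form a domain, so the components of top degree have nonzero product and
  -- the top degrees add up to `n`.
  have hne : part f.1 a * part g.1 b ≠ 0 := by
    refine mul_ne_zero (fun h => hfa ?_) (fun h => hgb ?_)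
    · simpa [hpart, hma] using congrArg (MvPowerSeries.coeff ma) h
    · simpa [hpart, hmb] using congrArg (MvPowerSeries.coeff mb) h
  obtain ⟨m, hm⟩ : ∃ m, MvPowerSeries.coeff m (part f.1 a * part g.1 b) ≠ 0 := by
    by_contra! hc
    exact hne (MvPowerSeries.ext hc)
  have hab : a + b = n := by
    have hdeg : m.degree = a + b := by
      rw [MvPowerSeries.coeff_mul] at hm
      obtain ⟨p, hp, h⟩ := Finset.exists_ne_zero_of_sum_ne_zero hm
      rw [Finset.HasAntidiagonal.mem_antidiagonal] at hp
      rw [hpart, hpart] at h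
      rw [← hp, map_add]
      split_ifs at h with h1 h2 <;> simp_all
    rw [← hdeg]
    refine hn m ?_
    convert hm using 1
    rw [MulMemClass.coe_mul, MvPowerSeries.coeff_mul, MvPowerSeries.coeff_mul]
    refine Finset.sum_congr rfl fun p hp => ?_
    rw [Finset.HasAntidiagonal.mem_antidiagonal] at hp
    rw [hpart, hpart]
    have hd : p.1.degree + p.2.degree = a + b := by rw [← map_add, hp, hdeg]
    by_cases h1 : MvPowerSeries.coeff p.1 f.1 = 0
    · simp [h1]
    by_cases h2 : MvPowerSeries.coeff p.2 g.1 = 0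
    · simp [h2]
    have := ha _ h1
    have := hb _ h2
    rw [if_pos (by omega), if_pos (by omega)]
  -- In lowest degree of `g`, the product only sees the constant term of `f`, so this degree is also
  -- `n`. Hence the top degree of `g` is at least `n`, leaving degree `0` for `f`.
  obtain ⟨m0, hm0, hmin⟩ := exists_minimalFor_of_wellFoundedLT
    (fun m : ℕ+ →₀ ℕ => MvPowerSeries.coeff m g.1 ≠ 0) (fun m => m.degree) ⟨mb, hgb⟩
  have hn0 : m0.degree = n := by
    refine hn m0 ?_
    rw [MulMemClass.coe_mul, MvPowerSeries.coeff_mul,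
      Finset.sum_eq_single_of_mem (0, m0) (by simp)]
    · exact mul_ne_zero hf hm0
    · intro p hp hne
      rw [Finset.HasAntidiagonal.mem_antidiagonal] at hp
      by_contra hc
      have h2 := hmin (right_ne_zero_of_mul hc)
      have hd : p.1.degree + p.2.degree = m0.degree := by rw [← map_add, hp]
      have h3 : p.1.degree = 0 := by
        by_contra h3
        have := h2 (by dsimp only; omega)
        dsimp only at this
        omega
      rw [Finsupp.degree_eq_zero_iff] at h3
      rw [h3, zero_add] at hp
      exact hne (Prod.ext h3 hp)
  have ha0 : a = 0 := by
    have := hb m0 hm0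
    omega
  have hfc : f = algebraMap ℂ QSym (constCoeff f) := by
    refine Subtype.ext (MvPowerSeries.ext fun m => ?_)
    change _ = MvPowerSeries.coeff m (MvPowerSeries.C (constCoeff f))
    rw [MvPowerSeries.coeff_C]
    split_ifs with h
    · rw [h, constCoeff_apply]
    · by_contra hc
      exact h ((Finsupp.degree_eq_zero_iff m).1 (by have := ha m hc; omega))
  rw [hfc]
  exact (IsUnit.mk0 _ hf).map _

end QSym

/-! ### Sums over lists of fixed length. -/

/-- Lists of a given length as a finset. -/
noncomputable def listsOfLength (P : Type*) [Fintype P] (n : ℕ) : Finset (List P) :=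
  (List.finite_length_eq P n).toFinset

theorem mem_listsOfLength {P : Type*} [Fintype P] {n : ℕ} {w : List P} : w ∈ listsOfLength P n ↔ w.length = n := by
  simp [listsOfLength]

theorem sum_listsOfLength_zero {P : Type*} [Fintype P] {M : Type*} [AddCommMonoid M] (F : List P → M) :
    ∑ w ∈ listsOfLength P 0, F w = F [] := by
  have : listsOfLength P 0 = {[]} := by
    ext w
    rw [mem_listsOfLength, Finset.mem_singleton, List.length_eq_zero_iff]
  rw [this, Finset.sum_singleton]

theorem sum_listsOfLength_succ {P : Type*} [Fintype P] {M : Type*} [AddCommMonoid M] (n : ℕ) (F : List P → M) :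
    ∑ w ∈ listsOfLength P (n + 1), F w = ∑ p, ∑ w ∈ listsOfLength P n, F (p :: w) := by
  rw [← Finset.sum_product']
  symm
  refine Finset.sum_bij (fun x _ => x.1 :: x.2) ?_ ?_ ?_ ?_
  · rintro ⟨p, w⟩ h
    simpa [mem_listsOfLength] using h
  · rintro ⟨p, w⟩ _ ⟨p', w'⟩ _ h
    simpa using h
  · intro w h
    rw [mem_listsOfLength] at h
    cases w with
    | nil => simp at h
    | cons p w => exact ⟨(p, w), by simpa [mem_listsOfLength] using h, rfl⟩
  · intro x _
    rfl

/-! ### Removal operators on formal combinations of subsets, and their nested commutators. -/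

section Combinatorics

variable {P : Type*} [PartialOrder P] [Fintype P]

attribute [local instance] LieRing.ofAssociativeRing

open Classical in
/-- The elements below `p`. -/
noncomputable def below (p : P) : Finset P := Finset.univ.filter (· ≤ p)

theorem mem_below {p x : P} : x ∈ below p ↔ x ≤ p := by
  classical
  simp [below]

open Classical in
/-- Removal of the principal lower set of `p` from `S`, provided that `p ∈ S` and that it removes
exactly `c` elements. -/
noncomputable def removeOp (p : P) (c : ℕ) : Module.End ℤ (Finset P →₀ ℤ) :=
  Finsupp.linearCombination ℤ fun S =>
    if p ∈ S ∧ (below p ∩ S).card = c then Finsupp.single (S \ below p) 1 else 0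

open Classical in
theorem removeOp_single (p : P) (c : ℕ) (S : Finset P) (n : ℤ) :
    removeOp p c (Finsupp.single S n) =
      if p ∈ S ∧ (below p ∩ S).card = c then Finsupp.single (S \ below p) n else 0 := by
  rw [removeOp, Finsupp.linearCombination_single]
  split_ifs <;> simp

/-- Removing one of two disjoint lower sets affects neither the membership nor the size test for the
other. -/
theorem removeOp_lie_of_disjoint {p q : P} (h : Disjoint (below p) (below q)) (c c' : ℕ) :
    ⁅removeOp p c, removeOp q c'⁆ = 0 := by
  classical
  have key : ∀ {p q : P}, Disjoint (below p) (below q) → ∀ S : Finset P,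
      (p ∈ S \ below q ↔ p ∈ S) ∧ below p ∩ (S \ below q) = below p ∩ S := by
    intro p q h S
    have hd := Finset.disjoint_left.1 h
    refine ⟨?_, ?_⟩
    · simp [hd (mem_below.2 le_rfl)]
    · ext x
      simp only [Finset.mem_inter, Finset.mem_sdiff]
      have := @hd x
      tauto
  rw [Ring.lie_def, sub_eq_zero]
  refine Finsupp.lhom_ext fun S n => ?_
  simp only [Module.End.mul_apply, removeOp_single]
  have h1 := key h S
  have h2 := key h.symm S
  by_cases hp : p ∈ S ∧ (below p ∩ S).card = c <;> by_cases hq : q ∈ S ∧ (below q ∩ S).card = c'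
  · rw [if_pos hp, if_pos hq, removeOp_single, removeOp_single, if_pos (by rwa [h1.1, h1.2]),
      if_pos (by rwa [h2.1, h2.2]), sdiff_sdiff_comm]
  · rw [if_pos hp, if_neg hq, removeOp_single, if_neg (by rwa [h2.1, h2.2]), map_zero]
  · rw [if_neg hp, if_pos hq, removeOp_single, if_neg (by rwa [h1.1, h1.2]), map_zero]
  · rw [if_neg hp, if_neg hq, map_zero, map_zero]

open Classical in
/-- The union of the principal lower sets of `r` and of the members of a list. -/
noncomputable def cover (r : P) : List P → Finset P
  | [] => below r
  | p :: w => below p ∪ cover r w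

theorem mem_cover {r x : P} {w : List P} : x ∈ cover r w ↔ ∃ p ∈ w ++ [r], x ≤ p := by
  induction w with
  | nil => simp [cover, mem_below]
  | cons p w ih =>
    simp only [cover, Finset.mem_union, ih, mem_below]
    simp

/-- The nested commutator of removal operators. -/
noncomputable def nestedOp (r : P) (c₀ : ℕ) : List P → List ℕ → Module.End ℤ (Finset P →₀ ℤ)
  | p :: w, c :: cs => ⁅removeOp p c, nestedOp r c₀ w cs⁆
  | _, _ => removeOp r c₀

/-- By the Jacobi identity, an operator commuting with every entry commutes with the nested
commutator. -/
theorem lie_nestedOp_of_disjoint {r p : P} {c c₀ : ℕ} {w : List P} {cs : List ℕ}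
    (h : Disjoint (below p) (cover r w)) : ⁅removeOp p c, nestedOp r c₀ w cs⁆ = 0 := by
  classical
  have hr : ∀ w, Disjoint (below p) (cover r w) → Disjoint (below p) (below r) := by
    intro w h
    rw [Finset.disjoint_left] at h ⊢
    exact fun x hx hx' => h hx (mem_cover.2 ⟨r, by simp, mem_below.1 hx'⟩)
  induction w generalizing cs with
  | nil => exact removeOp_lie_of_disjoint h _ _
  | cons q w ih =>
    cases cs with
    | nil => exact removeOp_lie_of_disjoint (hr _ h) _ _
    | cons c' cs =>
      rw [cover, Finset.disjoint_union_right] at h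
      rw [nestedOp, leibniz_lie, removeOp_lie_of_disjoint h.1, ih h.2, zero_lie, lie_zero, add_zero]

-- Every order of composition removes the same union of lower sets; only the coefficients depend on
-- the order.
open Classical in
theorem exists_nestedOp_single (r : P) (c₀ : ℕ) {w : List P} {cs : List ℕ}
    (hl : w.length = cs.length) (S : Finset P) (n : ℤ) : ∃ n' : ℤ,
      nestedOp r c₀ w cs (Finsupp.single S n) = Finsupp.single (S \ cover r w) n' := by
  have base : ∀ (p : P) (c : ℕ) (S : Finset P) (n : ℤ), ∃ n' : ℤ,
      removeOp p c (Finsupp.single S n) = Finsupp.single (S \ below p) n' := by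
    intro p c S n
    rw [removeOp_single]
    split_ifs
    · exact ⟨n, rfl⟩
    · exact ⟨0, by simp⟩
  induction w generalizing cs S n with
  | nil =>
    cases cs with
    | nil => exact base _ _ _ _
    | cons => simp at hl
  | cons p w ih =>
    cases cs with
    | nil => simp at hl
    | cons c cs =>
      have hl' : w.length = cs.length := by simpa using hl
      obtain ⟨n1, h1⟩ := ih hl' S n
      obtain ⟨n2, h2⟩ := base p c (S \ cover r w) n1
      obtain ⟨n3, h3⟩ := base p c S n
      obtain ⟨n4, h4⟩ := ih hl' (S \ below p) n3
      refine ⟨n2 - n4, ?_⟩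
      rw [nestedOp, Ring.lie_def, LinearMap.sub_apply, Module.End.mul_apply, Module.End.mul_apply,
        h1, h2, h3, h4, cover, Finsupp.single_sub, sdiff_sdiff_left, sdiff_sdiff_left,
        sup_comm (cover r w), Finset.sup_eq_union]

open Classical in
/-- The number in base `b` whose digits are the numbers of elements of `S` that are covered by the
successive members of a list, the digit of `r` being the leading one. -/
noncomputable def coverValue (b : ℕ) (r : P) (S : Finset P) : List P → ℕ
  | [] => (below r ∩ S).card
  | p :: w => ((below p ∩ S) \ cover r w).card + b * coverValue b r S w

/-- The number in base `b` with the given digits, `c₀` being the leading one. -/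
def digitValue (b c₀ : ℕ) : List ℕ → ℕ
  | [] => c₀
  | c :: cs => c + b * digitValue b c₀ cs

theorem coverValue_mono (b : ℕ) (r : P) {S S' : Finset P} (h : S' ⊆ S) (w : List P) :
    coverValue b r S' w ≤ coverValue b r S w := by
  classical
  induction w with
  | nil => exact Finset.card_le_card (Finset.inter_subset_inter_left h)
  | cons p w ih =>
    exact add_le_add (Finset.card_le_card
      (Finset.sdiff_subset_sdiff (Finset.inter_subset_inter_left h) le_rfl))
      (Nat.mul_le_mul_left b ih)

/-- Passing to `S'` increases no digit, and `x` is counted in exactly one digit, that of the last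
entry of `w ++ [r]`, read towards the leading one in reverse, only at the entry closest to `r` lying
above it. -/
theorem coverValue_lt {b : ℕ} (hb : 0 < b) (r : P) {S S' : Finset P} (h : S' ⊆ S) {x : P}
    (hx : x ∈ S) (hx' : x ∉ S') {w : List P} (hw : x ∈ cover r w) :
    coverValue b r S' w < coverValue b r S w := by
  classical
  induction w with
  | nil =>
    refine Finset.card_lt_card (Finset.ssubset_iff_of_subset
      (Finset.inter_subset_inter_left h) |>.2 ⟨x, ?_, ?_⟩)
    · exact Finset.mem_inter.2 ⟨hw, hx⟩
    · simp [hx']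
  | cons p w ih =>
    have hle : ((below p ∩ S') \ cover r w).card ≤ ((below p ∩ S) \ cover r w).card :=
      Finset.card_le_card
        (Finset.sdiff_subset_sdiff (Finset.inter_subset_inter_left h) le_rfl)
    by_cases hxw : x ∈ cover r w
    · exact add_lt_add_of_le_of_lt hle (Nat.mul_lt_mul_of_pos_left (ih hxw) hb)
    · refine add_lt_add_of_lt_of_le (Finset.card_lt_card (Finset.ssubset_iff_of_subset
        (Finset.sdiff_subset_sdiff (Finset.inter_subset_inter_left h) le_rfl) |>.2 ⟨x, ?_, ?_⟩))
        (Nat.mul_le_mul_left b (coverValue_mono b r h w))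
      · have : x ∈ below p := by simpa [cover, hxw] using hw
        simp [this, hx, hxw]
      · simp [hx']

theorem lt_or_eq_of_digits_lt {b u u' c c' : ℕ} (hc' : c' < b)
    (h : c + b * u < c' + b * u') : u < u' ∨ u = u' ∧ c < c' := by
  have h1 : u < u' + 1 := by
    refine Nat.lt_of_mul_lt_mul_left (a := b) ?_
    rw [Nat.mul_add]
    omega
  rcases Nat.lt_succ_iff_lt_or_eq.1 h1 with h2 | rfl
  · exact Or.inl h2
  · exact Or.inr ⟨rfl, by omega⟩

theorem digits_eq {b u u' c c' : ℕ} (hc : c < b) (hc' : c' < b)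
    (h : c + b * u = c' + b * u') : u = u' ∧ c = c' := by
  have hb : 0 < b := by omega
  have h1 : u = u' := by
    have := congrArg (· / b) h
    simpa [Nat.add_mul_div_left _ _ hb, Nat.div_eq_of_lt hc, Nat.div_eq_of_lt hc'] using this
  subst h1
  exact ⟨rfl, by omega⟩

/-- The prescribed sizes are lexicographically too large for what `S` offers, the innermost operator
being compared first. If the inner digits already fall short, the inner commutator kills both `S`
and every subset of it. -/
theorem nestedOp_single_eq_zero {b : ℕ} (hb : 0 < b) (r : P) (c₀ : ℕ) {w : List P}
    {cs : List ℕ} (hl : w.length = cs.length) (hcs : ∀ c ∈ cs, c < b) (S : Finset P) (n : ℤ)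
    (h : coverValue b r S w < digitValue b c₀ cs) :
    nestedOp r c₀ w cs (Finsupp.single S n) = 0 := by
  classical
  induction w generalizing cs S n with
  | nil =>
    cases cs with
    | nil => exact (removeOp_single _ _ _ _).trans (if_neg fun h' => h.ne h'.2)
    | cons => simp at hl
  | cons p w ih =>
    cases cs with
    | nil => simp at hl
    | cons c cs =>
      have hl' : w.length = cs.length := by simpa using hl
      have hcs' : ∀ c ∈ cs, c < b := fun c hc => hcs c (by simp [hc])
      rw [nestedOp, Ring.lie_def, LinearMap.sub_apply, Module.End.mul_apply, Module.End.mul_apply]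
      rcases lt_or_eq_of_digits_lt (hcs c (by simp)) h with h1 | ⟨h1, h2⟩
      · rw [ih hl' hcs' S n h1, map_zero, removeOp_single, zero_sub, neg_eq_zero]
        split_ifs
        · exact ih hl' hcs' _ n ((coverValue_mono b r Finset.sdiff_subset w).trans_lt h1)
        · exact map_zero _
      -- The inner digits agree and the outer one is too small. Applying the inner commutator first
      -- leaves fewer than `c` elements below `p`. Applying `p` first must remove `c` elements, one
      -- of which lies in the inner cover, so the inner value drops and induction applies.
      · obtain ⟨n', hn'⟩ := exists_nestedOp_single r c₀ hl' S n
        have hcard : (below p ∩ (S \ cover r w)).card < c := by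
          rwa [← Finset.inter_sdiff_assoc]
        rw [hn', removeOp_single, if_neg fun h' => hcard.ne h'.2, removeOp_single, zero_sub,
          neg_eq_zero]
        split_ifs with hp
        · refine ih hl' hcs' _ n (h1 ▸ ?_)
          obtain ⟨x, hx, hx'⟩ := Finset.exists_mem_notMem_of_card_lt_card (h2.trans_eq hp.2.symm)
          rw [Finset.mem_inter] at hx
          refine coverValue_lt hb r Finset.sdiff_subset (x := x) hx.2 (by simp [hx.1]) ?_
          by_contra hc
          exact hx' (by simp [hx, hc])
        · exact map_zero _

/-- Each member of a list is not below the later ones. -/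
def Irredundant (r : P) : List P → Prop
  | [] => True
  | p :: w => p ∉ cover r w ∧ Irredundant r w

/-- Each member of a list has a common lower bound with a later one. -/
def Linked (r : P) : List P → Prop
  | [] => True
  | p :: w => ¬ Disjoint (below p) (cover r w) ∧ Linked r w

-- At equality of values only one order of composition survives at each level. Removing below `p`
-- last passes its tests by irredundancy and equality of digits; removing it first takes an element
-- from the inner cover, by linkedness, and `nestedOp_single_eq_zero` kills the rest.
open Classical in
theorem nestedOp_single_univ {b : ℕ} (r : P) (c₀ : ℕ) {w : List P}
    {cs : List ℕ} (hl : w.length = cs.length) (hcs : ∀ c ∈ cs, c < b) (hP : Fintype.card P < b)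
    (hw : Irredundant r w) (hw' : Linked r w)
    (h : coverValue b r Finset.univ w = digitValue b c₀ cs) :
    nestedOp r c₀ w cs (Finsupp.single Finset.univ 1) =
      Finsupp.single (Finset.univ \ cover r w) 1 := by
  have hb : 0 < b := by omega
  induction w generalizing cs with
  | nil =>
    cases cs with
    | nil => exact (removeOp_single _ _ _ _).trans (if_pos ⟨Finset.mem_univ _, h⟩)
    | cons => simp at hl
  | cons p w ih =>
    cases cs with
    | nil => simp at hl
    | cons c cs =>
      have hl' : w.length = cs.length := by simpa using hl
      have hcs' : ∀ c ∈ cs, c < b := fun c hc => hcs c (by simp [hc])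
      obtain ⟨h1, h2⟩ := digits_eq ((Finset.card_le_univ _).trans_lt hP) (hcs c (by simp)) h
      have hp : p ∈ Finset.univ \ cover r w ∧ (below p ∩ (Finset.univ \ cover r w)).card = c :=
        ⟨by simp [hw.1], by rw [← h2, Finset.inter_sdiff_assoc]⟩
      rw [nestedOp, Ring.lie_def, LinearMap.sub_apply, Module.End.mul_apply, Module.End.mul_apply,
        ih hl' hcs' hw.2 hw'.2 h1, removeOp_single, if_pos hp, sdiff_sdiff_left,
        removeOp_single, cover, sup_comm, ← Finset.sup_eq_union, sub_eq_self]
      split_ifs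
      · refine nestedOp_single_eq_zero hb r c₀ hl' hcs' _ 1 (h1 ▸ ?_)
        obtain ⟨x, hx, hx'⟩ := Finset.not_disjoint_iff.1 hw'.1
        exact coverValue_lt hb r Finset.sdiff_subset (Finset.mem_univ x) (by simp [hx]) hx'
      · exact map_zero _

theorem nestedOp_eq_zero_of_not_linked {r : P} {c₀ : ℕ} {w : List P}
    {cs : List ℕ} (hl : w.length = cs.length) (hw : ¬ Linked r w) : nestedOp r c₀ w cs = 0 := by
  induction w generalizing cs with
  | nil => exact (hw trivial).elim
  | cons p w ih =>
    cases cs with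
    | nil => simp at hl
    | cons c cs =>
      rw [nestedOp]
      by_cases h : Linked r w
      · exact lie_nestedOp_of_disjoint (not_not.1 fun h' => hw ⟨h', h⟩)
      · rw [ih (by simpa using hl) h, lie_zero]

/-- An entry lying below a later one can be dropped. A cover of minimal length is therefore
irredundant. -/
theorem exists_shorter_of_not_irredundant {r : P} {w : List P} (hw : ¬ Irredundant r w) :
    ∃ w', w'.length < w.length ∧ cover r w' = cover r w := by
  classical
  induction w with
  | nil => exact (hw trivial).elim
  | cons p w ih =>
    by_cases h : Irredundant r w
    · have hp : p ∈ cover r w := not_not.1 fun h' => hw ⟨h', h⟩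
      refine ⟨w, by simp, (Finset.union_eq_right.2 fun x hx => ?_).symm⟩
      obtain ⟨q, hq, hpq⟩ := mem_cover.1 hp
      exact mem_cover.2 ⟨q, hq, (mem_below.1 hx).trans hpq⟩
    · obtain ⟨w', h1, h2⟩ := ih h
      exact ⟨p :: w', by simpa using h1, by rw [cover, cover, h2]⟩

/-- The digits of `coverValue` below the leading one. -/
noncomputable def coverDigits (r : P) : List P → List ℕ
  | [] => []
  | p :: w => (open Classical in ((below p ∩ Finset.univ) \ cover r w).card) :: coverDigits r w

theorem length_coverDigits (r : P) (w : List P) : (coverDigits r w).length = w.length := by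
  induction w with
  | nil => rfl
  | cons p w ih => simp [coverDigits, ih]

theorem coverDigits_lt (r : P) (w : List P) {c : ℕ} (hc : c ∈ coverDigits r w) :
    c < Fintype.card P + 1 := by
  classical
  induction w with
  | nil => simp [coverDigits] at hc
  | cons p w ih =>
    rcases List.mem_cons.1 hc with rfl | h
    · exact Nat.lt_succ_of_le (Finset.card_le_univ _)
    · exact ih h

theorem digitValue_coverDigits (b : ℕ) (r : P) (w : List P) :
    digitValue b (below r).card (coverDigits r w) = coverValue b r Finset.univ w := by
  classical
  induction w with
  | nil => simp [digitValue, coverDigits, coverValue]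
  | cons p w ih => simp [digitValue, coverDigits, coverValue, ih]

/-- The nested commutator of the sums of all removal operators. -/
noncomputable def nestedSum (P : Type*) [PartialOrder P] [Fintype P] (c₀ : ℕ) :
    List ℕ → Module.End ℤ (Finset P →₀ ℤ)
  | [] => ∑ p : P, removeOp p c₀
  | c :: cs => ⁅∑ p : P, removeOp p c, nestedSum P c₀ cs⁆

/-- Multilinearity of the bracket. -/
theorem nestedSum_eq_sum (c₀ : ℕ) (cs : List ℕ) :
    nestedSum P c₀ cs = ∑ r : P, ∑ w ∈ listsOfLength P cs.length, nestedOp r c₀ w cs := by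
  induction cs with
  | nil =>
    refine Finset.sum_congr rfl fun r _ => ?_
    rw [List.length_nil, sum_listsOfLength_zero]
    rfl
  | cons c cs ih =>
    rw [nestedSum, ih, List.length_cons]
    simp only [sum_listsOfLength_succ, nestedOp, sum_lie, lie_sum]
    exact Finset.sum_congr rfl fun r _ => Finset.sum_comm

/-- If some irredundant linked list covers `P` and no shorter list does, then for suitable digits
the nested commutator takes the full set to the empty set with a positive coefficient. -/
theorem exists_nestedSum_pos {r : P} {w : List P} (hw : Irredundant r w) (hw' : Linked r w)
    (hcov : cover r w = Finset.univ)
    (hmin : ∀ (r' : P) (w' : List P), cover r' w' = Finset.univ → w.length ≤ w'.length) :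
    ∃ c₀ cs, 0 < nestedSum P c₀ cs (Finsupp.single Finset.univ 1) ∅ := by
  classical
  -- With this base every digit is smaller than `b`, so comparing values is comparing digits
  -- lexicographically.
  set b := Fintype.card P + 1 with hb
  set G := (Finset.univ ×ˢ listsOfLength P w.length).filter fun x : P × List P =>
    Irredundant x.1 x.2 ∧ Linked x.1 x.2 ∧ cover x.1 x.2 = Finset.univ with hG
  -- The sizes are read off from a list of maximal value, so that every other list in `G` either
  -- falls short and contributes `0`, or ties and contributes `1`.
  obtain ⟨⟨r₁, w₁⟩, h₁, hmax⟩ := G.exists_max_image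
    (fun x => coverValue b x.1 Finset.univ x.2) ⟨(r, w), by simp [mem_listsOfLength, *]⟩
  simp only [hG, Finset.mem_filter, Finset.mem_product, Finset.mem_univ, true_and,
    mem_listsOfLength] at h₁ hmax
  obtain ⟨hl₁, hi₁, hk₁, hc₁⟩ := h₁
  refine ⟨(below r₁).card, coverDigits r₁ w₁, ?_⟩
  have hval := digitValue_coverDigits b r₁ w₁
  have hdig : ∀ c ∈ coverDigits r₁ w₁, c < b := fun c hc => coverDigits_lt r₁ w₁ hc
  have hP : Fintype.card P < b := Nat.lt_succ_self _
  have hpos : ∀ r' : P, ∀ w' ∈ listsOfLength P (coverDigits r₁ w₁).length,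
      0 ≤ nestedOp r' (below r₁).card w' (coverDigits r₁ w₁) (Finsupp.single Finset.univ 1) ∅ := by
    intro r' w' hl
    rw [mem_listsOfLength] at hl
    have hl' := hl
    rw [length_coverDigits, hl₁] at hl'
    by_cases hc : cover r' w' = Finset.univ
    · have hi : Irredundant r' w' := by
        by_contra hi
        obtain ⟨w'', h1, h2⟩ := exists_shorter_of_not_irredundant hi
        have := hmin r' w'' (h2.trans hc)
        omega
      by_cases hk : Linked r' w'
      · rcases (hmax (r', w') ⟨hl', hi, hk, hc⟩).lt_or_eq with h | h
        · rw [nestedOp_single_eq_zero (by omega) r' _ hl hdig _ _ (h.trans_eq hval.symm)]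
          simp
        · rw [nestedOp_single_univ r' _ hl hdig hP hi hk (h.trans hval.symm)]
          exact Finsupp.single_nonneg.2 zero_le_one ∅
      · rw [nestedOp_eq_zero_of_not_linked hl hk]
        simp
    · obtain ⟨n, hn⟩ := exists_nestedOp_single r' (below r₁).card hl Finset.univ 1
      rw [hn, Finsupp.single_eq_of_ne]
      intro h
      rw [eq_comm, Finset.sdiff_eq_empty_iff_subset, Finset.univ_subset_iff] at h
      exact hc h
  rw [nestedSum_eq_sum]
  simp only [LinearMap.sum_apply, Finsupp.finsetSum_apply]
  refine Finset.sum_pos' (fun r' _ => Finset.sum_nonneg (hpos r')) ⟨r₁, Finset.mem_univ _, ?_⟩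
  refine Finset.sum_pos' (hpos r₁) ⟨w₁, mem_listsOfLength.2 (length_coverDigits r₁ w₁).symm, ?_⟩
  rw [nestedOp_single_univ r₁ _ (length_coverDigits r₁ w₁).symm hdig hP hi₁ hk₁ hval.symm, hc₁]
  simp

end Combinatorics

/-! ### Generating functions of subsets of a poset. -/

section PosetSeries

variable {P : Type*} [PartialOrder P]

/-- A map `θ : P → ℕ` that is order-preserving and positive on `S`, vanishes outside `S`, and has
`m i` values equal to `i` for each `i > 0`. -/
structure IsPartition (S : Finset P) (m : ℕ+ →₀ ℕ) (θ : P → ℕ) : Prop where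
  ne_zero_iff : ∀ x, θ x ≠ 0 ↔ x ∈ S
  le : ∀ x ∈ S, ∀ y ∈ S, x ≤ y → θ x ≤ θ y
  ncard_eq : ∀ i : ℕ+, {x | θ x = i}.ncard = m i

theorem IsPartition.eq_zero {S : Finset P} {m : ℕ+ →₀ ℕ} {θ : P → ℕ} (h : IsPartition S m θ)
    {x : P} (hx : x ∉ S) : θ x = 0 :=
  not_not.1 fun h' => hx ((h.ne_zero_iff x).1 h')

/-- The generating function of the order-preserving maps `S → ℕ+`. -/
noncomputable def posetSeries (S : Finset P) : MvPowerSeries ℕ+ ℂ :=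
  fun m => ((Nat.card {θ // IsPartition S m θ} : ℕ) : ℂ)

theorem coeff_posetSeries (S : Finset P) (m : ℕ+ →₀ ℕ) :
    MvPowerSeries.coeff m (posetSeries S) = ((Nat.card {θ // IsPartition S m θ} : ℕ) : ℂ) :=
  rfl

/-- For a natural labeling the strict inequalities are vacuous, so only the order on the image of
`Q` matters. -/
theorem posetSeries_eq_partitionSeries {Q : Type*} [PartialOrder Q] [Fintype Q] {ω : Labeling Q}
    (hω : ω.IsNatural) (e : Q ↪o P) {S : Finset P} (hS : ∀ x, x ∈ S ↔ ∃ q, e q = x) :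
    posetSeries S = partitionSeries ω := by
  refine MvPowerSeries.ext fun m => ?_
  rw [coeff_posetSeries, coeff_partitionSeries]
  congr 1
  have hmem : ∀ q, e q ∈ S := fun q => (hS _).2 ⟨q, rfl⟩
  have hw : ∀ (θ : P → ℕ) (η : Q → ℕ+), (∀ q, (η q : ℕ) = θ (e q)) →
      (∀ x, x ∉ S → θ x = 0) → ∀ i : ℕ+, {x | θ x = i}.ncard = weight η i := by
    intro θ η h h0 i
    rw [weight_apply, ← Set.ncard_image_of_injective _ e.injective]
    congr 1
    ext x
    simp only [Set.mem_ofPred_eq, Set.mem_image, Set.mem_preimage, Set.mem_singleton_iff]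
    constructor
    · intro hx
      obtain ⟨q, rfl⟩ := (hS x).1 (by
        by_contra hc
        exact i.ne_zero (hx ▸ h0 x hc))
      exact ⟨q, PNat.eq ((h q).trans hx), rfl⟩
    · rintro ⟨q, rfl, rfl⟩
      exact (h q).symm
  let F : {θ // IsPartition S m θ} → {θ : Q → ℕ+ // IsPPartition ω θ ∧ weight θ = m} := fun θ =>
    ⟨fun q => ⟨θ.1 (e q), Nat.pos_of_ne_zero ((θ.2.ne_zero_iff _).2 (hmem q))⟩,
      ⟨fun x y h => θ.2.le _ (hmem x) _ (hmem y) (e.le_iff_le.2 h),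
        fun x y h h' => (h'.not_ge (hω x y h)).elim⟩,
      Finsupp.ext fun i => by
        rw [← θ.2.ncard_eq i]
        exact (hw θ.1 _ (fun _ => rfl)
          (fun x hx => not_not.1 fun h => hx ((θ.2.ne_zero_iff x).1 h)) i).symm⟩
  refine Nat.card_congr (Equiv.ofBijective F ⟨?_, ?_⟩)
  · rintro ⟨θ, h⟩ ⟨θ', h'⟩ hF
    refine Subtype.ext (funext fun x => ?_)
    by_cases hx : x ∈ S
    · obtain ⟨q, rfl⟩ := (hS x).1 hx
      have := congrFun (congrArg Subtype.val hF) q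
      exact congrArg PNat.val this
    · have h1 : θ x = 0 := not_not.1 fun h1 => hx ((h.ne_zero_iff x).1 h1)
      have h2 : θ' x = 0 := not_not.1 fun h1 => hx ((h'.ne_zero_iff x).1 h1)
      exact h1.trans h2.symm
  · rintro ⟨η, h1, h2⟩
    let θ : P → ℕ := Function.extend e (fun q => (η q : ℕ)) 0
    have hθ : ∀ q, (η q : ℕ) = θ (e q) := fun q => (e.injective.extend_apply (fun q => (η q : ℕ)) 0 q).symm
    have hθ0 : ∀ x, x ∉ S → θ x = 0 := fun x hx =>
      Function.extend_apply' _ _ _ fun h => hx ((hS x).2 h)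
    refine ⟨⟨θ, fun x => ⟨fun h => not_not.1 fun h' => h (hθ0 x h'), fun h => ?_⟩, ?_,
      fun i => by rw [hw θ η hθ hθ0, h2]⟩, ?_⟩
    · obtain ⟨q, rfl⟩ := (hS x).1 h
      rw [← hθ]
      exact (η q).ne_zero
    · intro x hx y hy hxy
      obtain ⟨q, rfl⟩ := (hS x).1 hx
      obtain ⟨q', rfl⟩ := (hS y).1 hy
      rw [← hθ, ← hθ]
      exact h1.le_of_le _ _ (e.le_iff_le.1 hxy)
    · exact Subtype.ext (funext fun q => PNat.eq (hθ q).symm)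

theorem exists_isNatural (Q : Type*) [PartialOrder Q] [Fintype Q] :
    ∃ ω : Labeling Q, ω.IsNatural := by
  let _ : Fintype (LinearExtension Q) := inferInstanceAs (Fintype Q)
  let e : LinearExtension Q ≃o Fin (Fintype.card Q) :=
    (Fintype.orderIsoFinOfCardEq (α := LinearExtension Q) (h := rfl)).symm
  exact ⟨e.toEquiv, fun x y h => e.monotone (toLinearExtension.monotone h)⟩

theorem posetSeries_mem_QSym (S : Finset P) : posetSeries S ∈ QSym := by
  obtain ⟨ω, hω⟩ := exists_isNatural S
  rw [posetSeries_eq_partitionSeries hω (OrderEmbedding.subtype (· ∈ S)) fun x => by simp]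
  exact partitionSeries_mem_QSym ω

/-- The generating function of the order-preserving maps `S → ℕ+`, as a quasisymmetric function. -/
noncomputable def posetGenFun (S : Finset P) : QSym :=
  ⟨posetSeries S, posetSeries_mem_QSym S⟩

theorem constCoeff_posetGenFun_empty :
    QSym.constCoeff (posetGenFun (∅ : Finset P)) = 1 := by
  rw [QSym.constCoeff_apply]
  change MvPowerSeries.coeff 0 (posetSeries (∅ : Finset P)) = 1
  rw [coeff_posetSeries, Nat.cast_eq_one, Nat.card_eq_one_iff_unique]
  refine ⟨⟨fun θ η => Subtype.ext (funext fun x => ?_)⟩, ⟨0, by simp, by simp, fun i => ?_⟩⟩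
  · rw [θ.2.eq_zero (by simp), η.2.eq_zero (by simp)]
  · have : {x : P | (0 : P → ℕ) x = i} = ∅ := by
      ext x
      simpa using i.ne_zero.symm
    rw [this]
    simp

variable [Fintype P]

theorem finite_isPartition (S : Finset P) (m : ℕ+ →₀ ℕ) : {θ | IsPartition S m θ}.Finite := by
  refine (Set.Finite.pi (ι := P) (t := fun _ => insert 0 ((↑) '' (m.support : Set ℕ+))) fun _ =>
    (m.support.finite_toSet.image _).insert _).subset fun θ hθ x _ => ?_
  rcases Nat.eq_zero_or_pos (θ x) with h | h
  · exact Or.inl h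
  · obtain ⟨i, hi⟩ : ∃ i : ℕ+, (i : ℕ) = θ x := ⟨⟨θ x, h⟩, rfl⟩
    refine Or.inr ⟨i, ?_, hi⟩
    rw [Finset.mem_coe, Finsupp.mem_support_iff, ← hθ.ncard_eq]
    exact Set.ncard_ne_zero_of_mem (a := x) hi.symm (Set.toFinite _)

instance (S : Finset P) (m : ℕ+ →₀ ℕ) : Finite {θ // IsPartition S m θ} :=
  (finite_isPartition S m).to_subtype

theorem posetGenFun_univ {ω : Labeling P} (hω : ω.IsNatural) :
    posetGenFun (Finset.univ : Finset P) = partitionGenFun ω :=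
  Subtype.ext (posetSeries_eq_partitionSeries hω (RelEmbedding.refl _) fun x => by simp)

theorem constCoeff_posetGenFun_of_nonempty {S : Finset P} (hS : S.Nonempty) :
    QSym.constCoeff (posetGenFun S) = 0 := by
  obtain ⟨x, hx⟩ := hS
  rw [QSym.constCoeff_apply]
  change MvPowerSeries.coeff 0 (posetSeries S) = 0
  rw [coeff_posetSeries, Nat.cast_eq_zero, Nat.card_eq_zero]
  refine Or.inl ⟨fun θ => ?_⟩
  obtain ⟨i, hi⟩ : ∃ i : ℕ+, (i : ℕ) = θ.1 x :=
    ⟨⟨θ.1 x, Nat.pos_of_ne_zero ((θ.2.ne_zero_iff x).2 hx)⟩, rfl⟩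
  exact Set.ncard_ne_zero_of_mem (a := x) hi.symm (Set.toFinite _) (θ.2.ncard_eq i)

/-- The lower sets of `S` with `k` elements. -/
noncomputable def lowerSubsets (S : Finset P) (k : ℕ) : Finset (Finset P) :=
  {I | I ⊆ S ∧ I.card = k ∧ ∀ x ∈ I, ∀ y ∈ S, y ≤ x → y ∈ I}.toFinite.toFinset

theorem mem_lowerSubsets {S I : Finset P} {k : ℕ} : I ∈ lowerSubsets S k ↔
    I ⊆ S ∧ I.card = k ∧ ∀ x ∈ I, ∀ y ∈ S, y ≤ x → y ∈ I := by
  rw [lowerSubsets, Set.Finite.mem_toFinset]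
  rfl

-- The fibre over `1` is a lower set `I` of `S` with `k` elements; subtracting `1` from the other
-- values leaves a map on `S \ I`.
open Classical in
theorem headCoeff_posetGenFun (S : Finset P) (k : ℕ) :
    QSym.headCoeff k (posetGenFun S) = ∑ I ∈ lowerSubsets S k, posetGenFun (S \ I) := by
  refine Subtype.ext (MvPowerSeries.ext fun m => ?_)
  rw [QSym.coeff_headCoeff, AddSubmonoidClass.coe_finsetSum, map_sum]
  change ((Nat.card {θ // IsPartition S (QSym.consExp k m) θ} : ℕ) : ℂ) =
    ∑ I ∈ lowerSubsets S k, ((Nat.card {θ // IsPartition (S \ I) m θ} : ℕ) : ℂ)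
  rw [← Nat.cast_sum, ← Finset.sum_coe_sort, ← Nat.card_sigma]
  congr 1
  symm
  have hset : ∀ I ∈ lowerSubsets S k, ∀ θ : P → ℕ, IsPartition (S \ I) m θ → ∀ x,
      x ∈ I ↔ x ∈ S ∧ θ x = 0 := by
    intro I hI θ hθ x
    have h1 := hθ.ne_zero_iff x
    have h2 := @(mem_lowerSubsets.1 hI).1 x
    rw [Finset.mem_sdiff] at h1
    tauto
  -- Elements of `I` have value `0` before the shift and so receive `1`; elements outside `S` must
  -- stay at `0`.
  let g : (P → ℕ) → P → ℕ := fun θ x => if x ∈ S then θ x + 1 else 0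
  let F : (Σ I : lowerSubsets S k, {θ // IsPartition (S \ I.1) m θ}) →
      {θ // IsPartition S (QSym.consExp k m) θ} := fun z => ⟨g z.2.1, by
    obtain ⟨⟨I, hI⟩, θ, hθ⟩ := z
    have hI' := mem_lowerSubsets.1 hI
    refine ⟨fun x => by simp [g], fun x hx y hy hxy => ?_, fun i => ?_⟩
    · simp only [g, hx, hy, if_true, add_le_add_iff_right]
      by_cases hyI : y ∈ I
      · rw [((hset I hI θ hθ x).1 (hI'.2.2 y hyI x hx hxy)).2]
        exact Nat.zero_le _
      by_cases hxI : x ∈ I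
      · rw [((hset I hI θ hθ x).1 hxI).2]
        exact Nat.zero_le _
      exact hθ.le x (by simp [hx, hxI]) y (by simp [hy, hyI]) hxy
    · by_cases hi : i = 1
      · rw [hi, QSym.consExp_one]
        refine Eq.trans ?_ hI'.2.1
        rw [← Set.ncard_coe_finset]
        congr 1
        ext x
        rw [Finset.mem_coe, hset I hI θ hθ x]
        by_cases hx : x ∈ S <;> simp [g, hx]
      · obtain ⟨j, rfl⟩ := PNat.exists_eq_succ_of_ne_one hi
        rw [QSym.consExp_add_one, ← hθ.ncard_eq j]
        congr 1
        ext x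
        by_cases hx : x ∈ S
        · simp [g, hx]
        · have h0 : θ x = 0 := hθ.eq_zero fun h => hx (Finset.mem_sdiff.1 h).1
          have hj := j.ne_zero
          simp [g, hx, h0, hj.symm]⟩
  refine Nat.card_congr (Equiv.ofBijective F ⟨?_, ?_⟩)
  · rintro ⟨⟨I, hI⟩, θ, hθ⟩ ⟨⟨J, hJ⟩, η, hη⟩ h
    have hg : ∀ x, g θ x = g η x := fun x => congrFun (congrArg Subtype.val h) x
    have hθη : θ = η := by
      funext x
      by_cases hx : x ∈ S
      · simpa [g, hx] using hg x
      · rw [hθ.eq_zero fun h => hx (Finset.mem_sdiff.1 h).1,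
          hη.eq_zero fun h => hx (Finset.mem_sdiff.1 h).1]
    subst hθη
    obtain rfl : I = J := by
      ext x
      rw [hset I hI θ hθ, hset J hJ θ hη]
    rfl
  · rintro ⟨θ, hθ⟩
    have h1 : ∀ x, θ x = 1 → x ∈ S := fun x hx => (hθ.ne_zero_iff x).1 (by omega)
    have hI : Finset.univ.filter (θ · = 1) ∈ lowerSubsets S k := by
      refine mem_lowerSubsets.2 ⟨fun x hx => h1 x (by simpa using hx), ?_, fun x hx y hy hyx => ?_⟩
      · rw [← QSym.consExp_one k m, ← hθ.ncard_eq, ← Set.ncard_coe_finset]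
        congr 1
        ext x
        simp
      · have hx' : θ x = 1 := by simpa using hx
        have := hθ.le y hy x (h1 x hx') hyx
        have := (hθ.ne_zero_iff y).2 hy
        simp only [Finset.mem_filter, Finset.mem_univ, true_and]
        omega
    refine ⟨⟨⟨_, hI⟩, fun x => θ x - 1, fun x => ?_, fun x hx y hy hxy => ?_, fun i => ?_⟩, ?_⟩
    · have := hθ.ne_zero_iff x
      rw [Finset.mem_sdiff, ← this]
      simp only [Finset.mem_filter, Finset.mem_univ, true_and]
      omega
    · exact Nat.sub_le_sub_right
        (hθ.le x (Finset.mem_sdiff.1 hx).1 y (Finset.mem_sdiff.1 hy).1 hxy) 1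
    · rw [← QSym.consExp_add_one k m i, ← hθ.ncard_eq]
      congr 1
      ext x
      have := i.pos
      simp only [Set.mem_ofPred_eq, PNat.add_coe, PNat.one_coe]
      omega
    · refine Subtype.ext (funext fun x => ?_)
      change g (fun x => θ x - 1) x = θ x
      by_cases hx : x ∈ S
      · have := (hθ.ne_zero_iff x).2 hx
        simp only [g, hx, if_true]
        omega
      · simp [g, hx, hθ.eq_zero hx]

-- The proposed value satisfies the recursion of `eq_powerOp`. Removing the part of `S` below `p`,
-- then a lower set `J` of what remains, amounts to removing one lower set `I` with a marked point
-- `p ∈ I`. The factor `k` counts the choices of `p`.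
open Classical in
theorem powerOp_posetGenFun (S : Finset P) (c : ℕ) :
    QSym.powerOp c (posetGenFun S) =
      ∑ p ∈ S.filter (fun p => (below p ∩ S).card = c), posetGenFun (S \ below p) := by
  symm
  refine QSym.eq_powerOp (X := fun c =>
    ∑ p ∈ S.filter (fun p => (below p ∩ S).card = c), posetGenFun (S \ below p)) (fun k => ?_) c
  have hR : k • QSym.headCoeff k (posetGenFun S) =
      ∑ I ∈ lowerSubsets S k, ∑ p ∈ I, posetGenFun (S \ I) := by
    rw [headCoeff_posetGenFun, Finset.smul_sum]
    refine Finset.sum_congr rfl fun I hI => ?_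
    rw [Finset.sum_const, (mem_lowerSubsets.1 hI).2.1]
  rw [hR]
  simp only [map_sum, headCoeff_posetGenFun]
  simp only [Finset.sum_sigma']
  have hself : ∀ p : P, p ∈ below p := fun p => mem_below.2 le_rfl
  refine Finset.sum_nbij'
    (fun z => ⟨(below z.2.1 ∩ S) ∪ z.2.2, z.2.1⟩)
    (fun z => ⟨(k - (below z.2 ∩ S).card, (below z.2 ∩ S).card), ⟨z.2, z.1 \ below z.2⟩⟩)
    ?_ ?_ ?_ ?_ ?_
  · rintro ⟨⟨i, j⟩, ⟨p, J⟩⟩ h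
    simp only [Finset.mem_sigma, Finset.HasAntidiagonal.mem_antidiagonal, Finset.mem_filter,
      mem_lowerSubsets] at h ⊢
    obtain ⟨hij, ⟨hp, hj⟩, hJ, hJi, hJl⟩ := h
    have hJS : J ⊆ S := hJ.trans Finset.sdiff_subset
    refine ⟨⟨Finset.union_subset Finset.inter_subset_right hJS, ?_, ?_⟩, ?_⟩
    · rw [Finset.card_union_of_disjoint, hj, hJi, add_comm, hij]
      rw [Finset.disjoint_left]
      intro x hx hx'
      exact (Finset.mem_sdiff.1 (hJ hx')).2 (Finset.mem_inter.1 hx).1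
    · intro x hx y hy hyx
      rw [Finset.mem_union, Finset.mem_inter, mem_below] at hx ⊢
      by_cases hyp : y ≤ p
      · exact Or.inl ⟨hyp, hy⟩
      · rcases hx with hx | hx
        · exact (hyp (hyx.trans hx.1)).elim
        · exact Or.inr (hJl x hx y (by simp [hy, mem_below, hyp]) hyx)
    · simp [hp, hself]
  · rintro ⟨I, p⟩ h
    simp only [Finset.mem_sigma, Finset.HasAntidiagonal.mem_antidiagonal, Finset.mem_filter,
      mem_lowerSubsets] at h ⊢
    obtain ⟨⟨hIS, hIk, hIl⟩, hp⟩ := h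
    have hsub : below p ∩ S ⊆ I := fun x hx => by
      rw [Finset.mem_inter, mem_below] at hx
      exact hIl p hp x hx.2 hx.1
    have heq : I \ below p = I \ (below p ∩ S) := by
      ext x
      have := @hIS x
      simp only [Finset.mem_sdiff, Finset.mem_inter]
      tauto
    have hle := Finset.card_le_card hsub
    refine ⟨by omega, ⟨hIS hp, trivial⟩, Finset.sdiff_subset_sdiff hIS le_rfl, ?_, ?_⟩
    · rw [heq, Finset.card_sdiff_of_subset hsub, hIk]
    · intro x hx y hy hyx
      rw [Finset.mem_sdiff] at hx hy ⊢
      exact ⟨hIl x hx.1 y hy.1 hyx, hy.2⟩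
  · rintro ⟨⟨i, j⟩, ⟨p, J⟩⟩ h
    simp only [Finset.mem_sigma, Finset.HasAntidiagonal.mem_antidiagonal, Finset.mem_filter,
      mem_lowerSubsets] at h ⊢
    obtain ⟨hij, ⟨hp, hj⟩, hJ, hJi, hJl⟩ := h
    have hJ' : (below p ∩ S ∪ J) \ below p = J := by
      ext x
      have := @hJ x
      simp only [Finset.mem_sdiff, Finset.mem_inter, Finset.mem_union] at this ⊢
      tauto
    rw [hj, hJ']
    obtain rfl : k - j = i := by omega
    rfl
  · rintro ⟨I, p⟩ h
    simp only [Finset.mem_sigma, mem_lowerSubsets] at h ⊢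
    obtain ⟨⟨hIS, hIk, hIl⟩, hp⟩ := h
    have : below p ∩ S ∪ I \ below p = I := by
      ext x
      have h1 := @hIS x
      have h2 := hIl p hp x
      simp only [Finset.mem_sdiff, Finset.mem_inter, Finset.mem_union, mem_below] at h1 h2 ⊢
      tauto
    rw [this]
  · rintro ⟨⟨i, j⟩, ⟨p, J⟩⟩ h
    simp only [Finset.mem_sigma, mem_lowerSubsets] at h ⊢
    congr 1
    ext x
    simp only [Finset.mem_sdiff, Finset.mem_inter, Finset.mem_union]
    tauto

-- Without relations between `A` and `B`, an order-preserving map on the union is an independent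
-- pair of maps; extended by zero, the pair is recombined by addition.
open Classical in
theorem posetGenFun_union {A B : Finset P} (hAB : Disjoint A B)
    (h : ∀ x ∈ A, ∀ y ∈ B, ¬ x ≤ y ∧ ¬ y ≤ x) :
    posetGenFun (A ∪ B) = posetGenFun A * posetGenFun B := by
  refine Subtype.ext (MvPowerSeries.ext fun m => ?_)
  rw [MulMemClass.coe_mul, MvPowerSeries.coeff_mul]
  change ((Nat.card {θ // IsPartition (A ∪ B) m θ} : ℕ) : ℂ) =
    ∑ p ∈ Finset.HasAntidiagonal.antidiagonal m,
      ((Nat.card {θ // IsPartition A p.1 θ} : ℕ) : ℂ) *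
      ((Nat.card {θ // IsPartition B p.2 θ} : ℕ) : ℂ)
  simp only [← Nat.cast_mul, ← Nat.card_prod]
  rw [← Nat.cast_sum, ← Finset.sum_coe_sort, ← Nat.card_sigma]
  congr 1
  symm
  have hdis := Finset.disjoint_left.1 hAB
  have hset : ∀ (θ η : P → ℕ), (∀ x, x ∉ A → θ x = 0) → (∀ x, x ∉ B → η x = 0) → ∀ i : ℕ+,
      {x | (θ + η) x = i}.ncard = {x | θ x = i}.ncard + {x | η x = i}.ncard := by
    intro θ η hθ hη i
    have hi := i.ne_zero
    have key : ∀ x, θ x = 0 ∨ η x = 0 := fun x => by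
      by_cases hx : x ∈ A
      · exact Or.inr (hη x (hdis hx))
      · exact Or.inl (hθ x hx)
    rw [← Set.ncard_union_eq]
    · congr 1
      ext x
      have := key x
      simp only [Pi.add_apply, Set.mem_ofPred_eq, Set.mem_union]
      omega
    · rw [Set.disjoint_left]
      intro x hx hx'
      have := key x
      simp only [Set.mem_ofPred_eq] at hx hx'
      omega
  let F : (Σ p : Finset.HasAntidiagonal.antidiagonal m,
      {θ // IsPartition A p.1.1 θ} × {θ // IsPartition B p.1.2 θ}) →
      {θ // IsPartition (A ∪ B) m θ} := fun z => ⟨z.2.1.1 + z.2.2.1, by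
    obtain ⟨⟨⟨m₁, m₂⟩, hm⟩, ⟨θ, hθ⟩, ⟨η, hη⟩⟩ := z
    rw [Finset.HasAntidiagonal.mem_antidiagonal] at hm
    refine ⟨fun x => ?_, fun x hx y hy hxy => ?_, fun i => ?_⟩
    · have h1 := hθ.ne_zero_iff x
      have h2 := hη.ne_zero_iff x
      rw [Finset.mem_union, ← h1, ← h2, Pi.add_apply]
      dsimp only
      omega
    · simp only [Pi.add_apply]
      rcases Finset.mem_union.1 hx with hx | hx <;> rcases Finset.mem_union.1 hy with hy | hy
      · rw [hη.eq_zero (hdis hx), hη.eq_zero (hdis hy)]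
        exact hθ.le x hx y hy hxy
      · exact ((h x hx y hy).1 hxy).elim
      · exact ((h y hy x hx).2 hxy).elim
      · rw [hθ.eq_zero fun h => hdis h hx, hθ.eq_zero fun h => hdis h hy, zero_add, zero_add]
        exact hη.le x hx y hy hxy
    · rw [hset _ _ (fun x hx => hθ.eq_zero hx) (fun x hx => hη.eq_zero hx), hθ.ncard_eq,
        hη.ncard_eq]
      exact DFunLike.congr_fun hm i⟩
  refine Nat.card_congr (Equiv.ofBijective F ⟨?_, ?_⟩)
  · rintro ⟨⟨⟨m₁, m₂⟩, hm⟩, ⟨θ, hθ⟩, ⟨η, hη⟩⟩ ⟨⟨⟨m₁', m₂'⟩, hm'⟩, ⟨θ', hθ'⟩, ⟨η', hη'⟩⟩ he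
    have he' : ∀ x, θ x + η x = θ' x + η' x := fun x => congrFun (congrArg Subtype.val he) x
    dsimp only at hθ hη hθ' hη'
    obtain rfl : θ = θ' := by
      funext x
      by_cases hx : x ∈ A
      · simpa [hη.eq_zero (hdis hx), hη'.eq_zero (hdis hx)] using he' x
      · rw [hθ.eq_zero hx, hθ'.eq_zero hx]
    obtain rfl : η = η' := by
      funext x
      exact add_left_cancel (he' x)
    obtain rfl : m₁ = m₁' := Finsupp.ext fun i => by rw [← hθ.ncard_eq, ← hθ'.ncard_eq]
    obtain rfl : m₂ = m₂' := Finsupp.ext fun i => by rw [← hη.ncard_eq, ← hη'.ncard_eq]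
    rfl
  · rintro ⟨θ, hθ⟩
    let r : Finset P → P → ℕ := fun S x => if x ∈ S then θ x else 0
    let c : Finset P → ℕ+ →₀ ℕ := fun S => Finsupp.onFinset m.support
      (fun i => {x | r S x = i}.ncard) fun i hi => by
        rw [Finsupp.mem_support_iff, ← hθ.ncard_eq]
        obtain ⟨x, hx⟩ := Set.nonempty_of_ncard_ne_zero hi
        refine Set.ncard_ne_zero_of_mem (a := x) ?_ (Set.toFinite _)
        have hi := i.ne_zero
        by_cases hxS : x ∈ S
        · simpa [r, hxS] using hx
        · simp [r, hxS, hi.symm] at hx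
    have hr : ∀ S ⊆ A ∪ B, IsPartition S (c S) (r S) := by
      intro S hS
      refine ⟨fun x => ?_, fun x hx y hy hxy => ?_, fun i => rfl⟩
      · by_cases hx : x ∈ S
        · simp [r, hx, (hθ.ne_zero_iff x).2 (hS hx)]
        · simp [r, hx]
      · simp only [r, hx, hy, if_true]
        exact hθ.le x (hS hx) y (hS hy) hxy
    have hsum : r A + r B = θ := by
      funext x
      by_cases hx : x ∈ A
      · simp [r, hx, hdis hx]
      · by_cases hx' : x ∈ B
        · simp [r, hx, hx']
        · simp [r, hx, hx', hθ.eq_zero (x := x) (by simp [hx, hx'])]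
    refine ⟨⟨⟨(c A, c B), ?_⟩, ⟨r A, hr A Finset.subset_union_left⟩,
      ⟨r B, hr B Finset.subset_union_right⟩⟩, Subtype.ext hsum⟩
    rw [Finset.HasAntidiagonal.mem_antidiagonal]
    ext i
    rw [← hθ.ncard_eq, ← hsum, hset _ _ (fun x hx => if_neg hx) (fun x hx => if_neg hx)]
    rfl

end PosetSeries

/-! ### Connectedness and linked covers by maximal elements. -/

section Connected

variable {P : Type*} [PartialOrder P] [Fintype P]

/-- In a finite poset the covering relation generates the order, so sets closed under comparability
are the unions of components of the Hasse diagram. -/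
theorem isConnectedPoset_iff : IsConnectedPoset P ↔ Nonempty P ∧
    ∀ A : Set P, A.Nonempty → (∀ x y, x ≤ y → (x ∈ A ↔ y ∈ A)) → A = Set.univ := by
  classical
  rw [IsConnectedPoset, SimpleGraph.connected_iff]
  constructor
  · rintro ⟨hpre, hne⟩
    refine ⟨hne, fun A ⟨a, ha⟩ hA => Set.eq_univ_of_forall fun b => ?_⟩
    obtain ⟨w⟩ := hpre a b
    induction w with
    | nil => exact ha
    | cons h _ ih =>
      refine ih ?_
      rw [SimpleGraph.hasse_adj] at h
      rcases h with h | h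
      · exact (hA _ _ h.le).1 ha
      · exact (hA _ _ h.le).2 ha
  · rintro ⟨hne, h⟩
    refine ⟨fun a b => ?_, hne⟩
    let _ : LocallyFiniteOrder P := Fintype.toLocallyFiniteOrder
    have hle : ∀ x y : P, x ≤ y → (SimpleGraph.hasse P).Reachable x y := by
      intro x y hxy
      induction le_iff_reflTransGen_covBy.1 hxy with
      | refl => exact SimpleGraph.Reachable.refl x
      | tail h1 h2 ih =>
        exact (ih (le_iff_reflTransGen_covBy.2 h1)).trans
          (SimpleGraph.Adj.reachable (SimpleGraph.hasse_adj.2 (Or.inl h2)))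
    have := h {y | (SimpleGraph.hasse P).Reachable a y} ⟨a, SimpleGraph.Reachable.refl a⟩
      fun x y hxy => ⟨fun hx => hx.trans (hle x y hxy), fun hy => hy.trans (hle x y hxy).symm⟩
    exact (Set.ext_iff.1 this b).2 trivial

/-- In a connected poset, the principal lower sets of the maximal elements can be arranged in such
a way that each one meets the union of the previous ones. -/
theorem exists_linked_cover (h : IsConnectedPoset P) : ∃ (r : P) (w : List P),
    Linked r w ∧ Irredundant r w ∧ cover r w = Finset.univ ∧
    ∀ (r' : P) (w' : List P), cover r' w' = Finset.univ → w.length ≤ w'.length := by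
  classical
  rw [isConnectedPoset_iff] at h
  obtain ⟨⟨x₀⟩, hconn⟩ := h
  have hmax : ∀ x : P, ∃ p, x ≤ p ∧ IsMax p := fun x => by
    obtain ⟨p, hp, hp'⟩ := Finite.exists_le_maximal (p := fun _ : P => True) (a := x) trivial
    exact ⟨p, hp, fun y hy => hp'.2 trivial hy⟩
  obtain ⟨r, -, hr⟩ := hmax x₀
  let Good : List P → Prop := fun w =>
    Linked r w ∧ Irredundant r w ∧ (∀ p ∈ w ++ [r], IsMax p) ∧ (w ++ [r]).Nodup
  have hbound : ∀ w, Good w → w.length ≤ Fintype.card P := fun w hw => by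
    have := hw.2.2.2.length_le_card
    rw [List.length_append] at this
    omega
  obtain ⟨w, hw, hwmax⟩ : ∃ w, Good w ∧ ∀ w', Good w' → w'.length ≤ w.length := by
    obtain ⟨_, ⟨w, hw, rfl⟩, h2⟩ := Set.exists_max_image {n : ℕ | ∃ w, Good w ∧ w.length = n} id
      ((Set.finite_le_nat (Fintype.card P)).subset
        (by rintro _ ⟨w, hw, rfl⟩; exact hbound w hw))
      ⟨0, [], ⟨trivial, trivial, by simpa using hr, by simp⟩, rfl⟩
    exact ⟨w, hw, fun w' hw' => h2 _ ⟨w', hw', rfl⟩⟩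
  obtain ⟨hl, hi, hm, hnd⟩ := hw
  -- Otherwise `p` could be put in front of the longest good list `w`.
  have hext : ∀ p, IsMax p → ¬ Disjoint (below p) (cover r w) → p ∈ cover r w := by
    intro p hp hd
    by_contra hc
    have hnot : p ∉ w ++ [r] := fun h => hc (mem_cover.2 ⟨p, h, le_rfl⟩)
    have := hwmax (p :: w) ⟨⟨hd, hl⟩, ⟨hc, hi⟩, by
      intro q hq
      rcases List.mem_cons.1 hq with rfl | hq
      · exact hp
      · exact hm q hq, List.nodup_cons.2 ⟨hnot, hnd⟩⟩
    simp at this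
  have hlow : ∀ x y, x ≤ y → y ∈ cover r w → x ∈ cover r w := fun x y hxy hy => by
    obtain ⟨p, hp, hyp⟩ := mem_cover.1 hy
    exact mem_cover.2 ⟨p, hp, hxy.trans hyp⟩
  -- The cover is a lower set. It is also closed upwards: if it contains `x ≤ y`, a maximal element
  -- above `y` has a lower set meeting it at `x`.
  have hcov : cover r w = Finset.univ := by
    have := hconn (cover r w : Set P) ⟨r, mem_cover.2 ⟨r, by simp, le_rfl⟩⟩ fun x y hxy =>
      ⟨fun hx => by
        obtain ⟨p, hyp, hp⟩ := hmax y
        exact hlow y p hyp (hext p hp (Finset.not_disjoint_iff.2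
          ⟨x, mem_below.2 (hxy.trans hyp), hx⟩)), hlow x y hxy⟩
    exact_mod_cast this
  refine ⟨r, w, hl, hi, hcov, fun r' w' hcov' => ?_⟩
  -- A maximal element is covered only by itself, so every cover lists all the distinct maximal
  -- elements in `w ++ [r]`.
  have hsub : w ++ [r] ⊆ w' ++ [r'] := fun p hp => by
    obtain ⟨q, hq, hpq⟩ := mem_cover.1 (hcov' ▸ Finset.mem_univ p)
    rwa [(hm p hp).eq_of_le hpq]
  have := (List.subperm_of_subset hnd hsub).length_le
  simpa using this

end Connected

/-! ### From connectedness to irreducibility and back. -/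

section Irreducible

variable {P : Type*} [PartialOrder P] [Fintype P]

attribute [local instance] LieRing.ofAssociativeRing

/-- Linear combinations of subsets of `P`, as quasisymmetric functions. -/
noncomputable def subsetGenFun (P : Type*) [PartialOrder P] [Fintype P] :
    (Finset P →₀ ℤ) →ₗ[ℤ] QSym :=
  Finsupp.linearCombination ℤ posetGenFun

theorem subsetGenFun_single (S : Finset P) (n : ℤ) :
    subsetGenFun P (Finsupp.single S n) = n • posetGenFun S :=
  Finsupp.linearCombination_single ℤ n S

/-- This moves commutator computations from `QSym` to formal combinations of subsets, where the sum
splits into operators for single elements `p`. -/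
theorem powerDer_subsetGenFun (c : ℕ) (v : Finset P →₀ ℤ) :
    QSym.powerDer c (subsetGenFun P v) = subsetGenFun P ((∑ p : P, removeOp p c) v) := by
  classical
  induction v using Finsupp.induction_linear with
  | zero => simp
  | add f g hf hg => rw [map_add, map_add, hf, hg, map_add, map_add]
  | single S n =>
    rw [subsetGenFun_single, map_zsmul, QSym.powerDer_apply, powerOp_posetGenFun,
      LinearMap.sum_apply, map_sum, ← Finset.sum_zsmul, Finset.sum_filter,
      ← Finset.sum_subset (Finset.subset_univ S)]
    · refine Finset.sum_congr rfl fun p hp => ?_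
      rw [removeOp_single]
      by_cases h : (below p ∩ S).card = c
      · rw [if_pos h, if_pos ⟨hp, h⟩, subsetGenFun_single]
      · rw [if_neg h, if_neg fun h' => h h'.2, map_zero]
    · intro p _ hp
      rw [removeOp_single, if_neg fun h' => hp h'.1, map_zero]

/-- The nested commutator of the derivations `QSym.powerDer`. -/
noncomputable def nestedDer (c₀ : ℕ) : List ℕ → Derivation ℂ QSym QSym
  | [] => QSym.powerDer c₀
  | c :: cs => ⁅QSym.powerDer c, nestedDer c₀ cs⁆

theorem nestedDer_subsetGenFun (c₀ : ℕ) (cs : List ℕ) (v : Finset P →₀ ℤ) :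
    nestedDer c₀ cs (subsetGenFun P v) = subsetGenFun P (nestedSum P c₀ cs v) := by
  induction cs generalizing v with
  | nil => exact powerDer_subsetGenFun c₀ v
  | cons c cs ih =>
    rw [nestedDer, Derivation.commutator_apply, ih, powerDer_subsetGenFun, powerDer_subsetGenFun,
      ih, ← map_sub]
    rfl

/-- Only the empty subset has a generating function with nonzero constant term, namely `1`. -/
theorem constCoeff_subsetGenFun (v : Finset P →₀ ℤ) :
    QSym.constCoeff (subsetGenFun P v) = (v ∅ : ℂ) := by
  classical
  induction v using Finsupp.induction_linear with
  | zero => simp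
  | add f g hf hg => rw [map_add, map_add, hf, hg, Finsupp.add_apply, Int.cast_add]
  | single S n =>
    rw [subsetGenFun_single, map_zsmul]
    rcases S.eq_empty_or_nonempty with rfl | hS
    · rw [constCoeff_posetGenFun_empty]
      simp
    · rw [constCoeff_posetGenFun_of_nonempty hS, Finsupp.single_eq_of_ne hS.ne_empty.symm]
      simp

theorem irreducible_of_isConnectedPoset (h : IsConnectedPoset P) {ω : Labeling P}
    (hω : ω.IsNatural) : Irreducible (partitionGenFun ω) := by
  obtain ⟨r, w, hl, hi, hcov, hmin⟩ := exists_linked_cover h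
  obtain ⟨c₀, cs, hpos⟩ := exists_nestedSum_pos hi hl hcov hmin
  have hne : QSym.constCoeff (nestedDer c₀ cs (partitionGenFun ω)) ≠ 0 := by
    have := subsetGenFun_single (Finset.univ : Finset P) 1
    rw [one_smul, posetGenFun_univ hω] at this
    rw [← this, nestedDer_subsetGenFun, constCoeff_subsetGenFun]
    exact_mod_cast hpos.ne'
  have h0 : QSym.constCoeff (partitionGenFun ω) = 0 := by
    rw [← posetGenFun_univ hω]
    exact constCoeff_posetGenFun_of_nonempty ⟨r, Finset.mem_univ r⟩
  have hK : partitionGenFun ω ≠ 0 := fun h => hne (by rw [h, map_zero, map_zero])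
  have hdeg : ∀ m, MvPowerSeries.coeff m (partitionGenFun ω).1 ≠ 0 →
      m.degree = Fintype.card P := by
    intro m hm
    change MvPowerSeries.coeff m (partitionSeries ω) ≠ 0 at hm
    rw [coeff_partitionSeries, Nat.cast_ne_zero] at hm
    obtain ⟨⟨θ, -, rfl⟩⟩ := (Nat.card_ne_zero.1 hm).1
    simp [weight, map_sum]
  refine ⟨fun hu => (hu.map QSym.constCoeff).ne_zero h0, fun f g hfg => ?_⟩
  by_cases hf : QSym.constCoeff f = 0
  · by_cases hg : QSym.constCoeff g = 0
    · exact (hne (hfg ▸ QSym.constCoeff_derivation_mul _ hf hg)).elim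
    · rw [hfg, mul_comm] at hK hdeg
      exact Or.inr (QSym.isUnit_of_mul_homogeneous hK hdeg hg)
  · rw [hfg] at hK hdeg
    exact Or.inl (QSym.isUnit_of_mul_homogeneous hK hdeg hf)

theorem isConnectedPoset_of_irreducible {ω : Labeling P} (hω : ω.IsNatural)
    (h : Irreducible (partitionGenFun ω)) : IsConnectedPoset P := by
  classical
  rw [← posetGenFun_univ hω] at h
  have hnot : ∀ S : Finset P, IsUnit (posetGenFun S) → S = ∅ := fun S hS => by
    by_contra hc
    exact (hS.map QSym.constCoeff).ne_zero
      (constCoeff_posetGenFun_of_nonempty (Finset.nonempty_iff_ne_empty.2 hc))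
  -- The series of the empty poset is idempotent; being nonzero in a domain, it is then `1`, a unit,
  -- which excludes empty `P`.
  have h2 := posetGenFun_union (A := (∅ : Finset P)) (B := ∅) (by simp) (by simp)
  rw [Finset.union_empty] at h2
  rw [isConnectedPoset_iff]
  refine ⟨?_, fun A hA hAc => ?_⟩
  · by_contra hP
    rw [not_nonempty_iff] at hP
    have h1 : (Finset.univ : Finset P) = ∅ := Finset.univ_eq_empty
    have hne : posetGenFun (∅ : Finset P) ≠ 0 := h1 ▸ h.ne_zero
    have h3 : posetGenFun (∅ : Finset P) = 1 := mul_left_cancel₀ hne (by rw [← h2, mul_one])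
    exact h.not_isUnit (by rw [h1, h3]; exact isUnit_one)
  -- Closure of `A` under comparability gives a factorization along `A` and its complement. A
  -- nonempty part has constant term `0` and is no unit, so the complement is empty.
  · set S := Finset.univ.filter (· ∈ A) with hS
    have hmul : posetGenFun (Finset.univ : Finset P) = posetGenFun S * posetGenFun Sᶜ := by
      rw [← posetGenFun_union disjoint_compl_right, Finset.union_compl]
      intro x hx y hy
      have hx' : x ∈ A := by simpa [hS] using hx
      have hy' : y ∉ A := by simpa [hS] using hy
      exact ⟨fun h => hy' ((hAc x y h).1 hx'), fun h => hy' ((hAc y x h).2 hx')⟩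
    rcases h.isUnit_or_isUnit hmul with h1 | h1
    · obtain ⟨a, ha⟩ := hA
      have : a ∈ S := by simpa [hS] using ha
      rw [hnot S h1] at this
      simp at this
    · have := hnot _ h1
      rw [Finset.compl_eq_empty_iff] at this
      refine Set.eq_univ_of_forall fun x => ?_
      have hx : x ∈ S := this ▸ Finset.mem_univ x
      simpa [hS] using hx

end Irreducible

theorem mainTheorem1 {P : Type*} [PartialOrder P] [Fintype P] (ω : Labeling P)
    (hω : ω.IsNatural) :
    IsConnectedPoset P ↔ Irreducible (partitionGenFun ω) :=
  ⟨fun h => irreducible_of_isConnectedPoset h hω, isConnectedPoset_of_irreducible hω⟩
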